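/- Let $n\ge 2$, $m\ge 0$, let $D\subseteq\mathbb{C}^2$ be a domain (nonempty, open, connected) and let $h_1,\dots,h_m$ be holomorphic functions of $(x,y)$ on $D$ (constant functions $h_i$ play the role of parameters). Consider the ordinary differential equation $$y^{(n)}+f(x,y,y',\dots,y^{(n-1)})=0,\qquad f=\frac{M}{N}\in\mathbb{C}(x,y,h_1,\dots,h_m,y',\dots,y^{(n-1)}),\tag{1}$$ where $M,N$ are the numerator and the denominator of $f$ (as a rational function in independent indeterminates $x,y,h_i,y^{(k)}$) and $N$ does not vanish identically after the given functions $h_i(x,y)$ are inserted. The most basic case is $m=0$, $D=\mathbb{C}^2$, that is, $f\in\mathbb{C}(x,y,y',\dots,y^{(n-1)})$. All functions are holomorphic. **Linearizability.** Equation (1) is *linearizable by a point transformation* if there are a nonempty open set $U\subseteq D$, holomorphic functions $\varphi,\psi$ on $U$ such that $(\varphi,\psi)$ is injective on $U$ and $J:=\varphi_x\psi_y-\varphi_y\psi_x$ vanishes nowhere on $U$, and holomorphic functions $a_0,\dots,a_{n-1}$ on $\psi(U)$, such that $u=\varphi(x,y)$, $t=\psi(x,y)$ maps (1) into the linear equation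 $$u^{(n)}(t)+\sum_{k=0}^{n-1}a_k(t)\,u^{(k)}(t)=0 .$$ This means: whenever $y$ is holomorphic on an open set $V\subseteq\mathbb{C}$, with $(x,y(x))\in U$ and $N\ne 0$ along $y$ on $V$, and $u$ is holomorphic near $\{\psi(x,y(x)):x\in V\}$ with $u(\psi(x,y(x)))=\varphi(x,y(x))$ on $V$, then $y$ satisfies (1) on $V$ if and only if $u$ satisfies the linear equation at all points $t=\psi(x,y(x))$, $x\in V$. Equation (1) is *linearizable to normal form* if, in addition, the linear equation can be taken in the form $$u^{(n)}(t)+\sum_{k=0}^{n-3}a_k(t)\,u^{(k)}(t)=0,\tag{2}$$ that is, $u''(t)=0$ for $n=2$ and the Laguerre–Forsyth normal form for $n\ge 3$. **Linearizing differential system.** Let $D_x=\partial_x+y'\partial_y+y''\partial_{y'}+\cdots$ be the total derivative and $\delta:=D_x\psi=\psi_x+\psi_y y'$. Substitute $u=\varphi$, $u'=D_x\varphi/\delta$, $u^{(k+1)}=D_x(u^{(k)})/\delta$ into the left-hand side of (2), with $a_k$ regarded as functions $a_k(x,y)$. One obtains $$u^{(n)}+\sum_{k=0}^{n-3}a_k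 u^{(k)}=-\frac{J\,\delta^{\,n-2}\,y^{(n)}+R}{\delta^{2n-1}},$$ where $R$ is a polynomial in $y',\dots,y^{(n-1)}$ whose coefficients are differential polynomials in $\varphi,\psi$ and, if $n\ge3$, the $a_k$; thus (2) becomes $y^{(n)}+R/(J\delta^{n-2})=0$. The linearizing differential system consists of * the equations expressing that all coefficients of the polynomial $R\,N-J\,M\,(\psi_x+\psi_y y')^{n-2}$ in $y',\dots,y^{(n-1)}$ vanish; * the equations $\psi_y\,(a_k)_x-\psi_x\,(a_k)_y=0$ for $0\le k\le n-3$ (none if $n=2$); * the inequation $J=\varphi_x\psi_y-\varphi_y\psi_x\neq0$. It *has a solution* if there are a nonempty open set $U\subseteq D$ and holomorphic functions $\varphi,\psi,a_0,\dots,a_{n-3}$ on $U$ satisfying all the equations identically on $U$ and the inequation at every point of $U$. **Theorem.** Equation (1) is linearizable by a point transformation if and only if its linearizing differential system has a solution. Likewise, (1) is linearizable to normal form if and only if its linearizing differential system has a solution. -/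

import Mathlib

noncomputable section

namespace LinODE

/-! ### The ordinary differential equation -/

/-- The arguments of the right-hand side of an equation of order `n`: the independent variable `x`,
the dependent variable `y`, further given functions `h 0, …, h (m - 1)` of `(x, y)` (a parameter is
a constant function), and the derivatives; `dy k` stands for `y^{(k+1)}`, so that
`y', …, y^{(n-1)}` occur. -/
inductive EqVar (n m : ℕ) : Type
  | x : EqVar n m
  | y : EqVar n m
  | h (i : Fin m) : EqVar n m
  | dy (k : Fin (n - 1)) : EqVar n m

/-- The field `ℂ(x, y, h 0, …, h (m - 1), y', …, y^{(n-1)})`. -/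
abbrev RatFun (n m : ℕ) : Type := FractionRing (MvPolynomial (EqVar n m) ℂ)

/-- The numerator `M` of `f`. -/
def numerator {n m : ℕ} (f : RatFun n m) : MvPolynomial (EqVar n m) ℂ :=
  IsFractionRing.num (MvPolynomial (EqVar n m) ℂ) f

/-- The denominator `N` of `f`. -/
def denominator {n m : ℕ} (f : RatFun n m) : MvPolynomial (EqVar n m) ℂ :=
  (IsFractionRing.den (MvPolynomial (EqVar n m) ℂ) f : MvPolynomial (EqVar n m) ℂ)

/-- The values of the arguments at the point `p = (x, y)` with derivatives `z`, where `z k` is the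
value of `y^{(k+1)}`. -/
def EqVar.value {n m : ℕ} (h : Fin m → ℂ × ℂ → ℂ) (p : ℂ × ℂ) (z : Fin (n - 1) → ℂ) :
    EqVar n m → ℂ
  | .x => p.1
  | .y => p.2
  | .h i => h i p
  | .dy k => z k

/-- The value of a polynomial in the arguments of the equation. -/
def evalAt {n m : ℕ} (h : Fin m → ℂ × ℂ → ℂ) (p : ℂ × ℂ) (z : Fin (n - 1) → ℂ)
    (g : MvPolynomial (EqVar n m) ℂ) : ℂ :=
  MvPolynomial.eval (EqVar.value h p z) g

/-- The derivatives `y'(x), …, y^{(n-1)}(x)` of a function. -/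
def derivs (n : ℕ) (y : ℂ → ℂ) (x : ℂ) : Fin (n - 1) → ℂ :=
  fun k => iteratedDeriv (k + 1) y x

/-- `f` is defined along the graph of `y` at `x`. -/
def IsRegularAt {n m : ℕ} (f : RatFun n m) (h : Fin m → ℂ × ℂ → ℂ) (y : ℂ → ℂ) (x : ℂ) : Prop :=
  evalAt h (x, y x) (derivs n y x) (denominator f) ≠ 0

/-- The equation `y^{(n)} + f(x, y, y', …, y^{(n-1)}) = 0` at `x`. -/
def OdeAt {n m : ℕ} (f : RatFun n m) (h : Fin m → ℂ × ℂ → ℂ) (y : ℂ → ℂ) (x : ℂ) : Prop :=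
  iteratedDeriv n y x +
    evalAt h (x, y x) (derivs n y x) (numerator f) /
      evalAt h (x, y x) (derivs n y x) (denominator f) = 0

/-- The linear equation `u^{(n)}(t) + ∑_{k < r} a_k(t) u^{(k)}(t) = 0` at `t`. -/
def LinearOdeAt (n r : ℕ) (a : Fin r → ℂ → ℂ) (u : ℂ → ℂ) (t : ℂ) : Prop :=
  iteratedDeriv n u t + ∑ k : Fin r, a k t * iteratedDeriv k u t = 0

/-! ### Point transformations -/

/-- The partial derivative with respect to the first variable. -/
def pdx (F : ℂ × ℂ → ℂ) : ℂ × ℂ → ℂ := fun p => deriv (fun s => F (s, p.2)) p.1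

/-- The partial derivative with respect to the second variable. -/
def pdy (F : ℂ × ℂ → ℂ) : ℂ × ℂ → ℂ := fun p => deriv (fun s => F (p.1, s)) p.2

/-- `u = φ(x, y)`, `t = ψ(x, y)` is an invertible point transformation on the open set `U`. -/
structure IsPointTransformation (φ ψ : ℂ × ℂ → ℂ) (U : Set (ℂ × ℂ)) : Prop where
  isOpen : IsOpen U
  nonempty : U.Nonempty
  analytic_phi : AnalyticOnNhd ℂ φ U
  analytic_psi : AnalyticOnNhd ℂ ψ U
  injOn : Set.InjOn (fun p => (φ p, ψ p)) U
  jacobian_ne_zero : ∀ p ∈ U, pdx φ p * pdy ψ p - pdy φ p * pdx ψ p ≠ 0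

/-- The point transformation maps the equation `y^{(n)} + f = 0` into the linear equation with the
coefficients `a`: whenever the graph of `y` runs in `U`, in the domain of definition of `f`, and is
mapped to the graph of `u`, that is, `u(ψ(x, y(x))) = φ(x, y(x))`, the function `y` is a solution of
the first equation if and only if `u` is a solution of the second one. -/
def MapsEquation {n m : ℕ} (f : RatFun n m) (h : Fin m → ℂ × ℂ → ℂ) {r : ℕ} (a : Fin r → ℂ → ℂ)
    (φ ψ : ℂ × ℂ → ℂ) (U : Set (ℂ × ℂ)) : Prop :=
  ∀ (V : Set ℂ) (y u : ℂ → ℂ), IsOpen V → AnalyticOnNhd ℂ y V →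
    (∀ x ∈ V, (x, y x) ∈ U) → (∀ x ∈ V, IsRegularAt f h y x) →
    AnalyticOnNhd ℂ u ((fun x => ψ (x, y x)) '' V) →
    (∀ x ∈ V, u (ψ (x, y x)) = φ (x, y x)) →
    ((∀ x ∈ V, OdeAt f h y x) ↔ ∀ x ∈ V, LinearOdeAt n r a u (ψ (x, y x)))

/-- The equation `y^{(n)} + f = 0`, with the functions `h` given on `D`, can be mapped by an
invertible point transformation on some nonempty open subset of `D` into a linear equation
`u^{(n)}(t) + ∑_{k < r} a_k(t) u^{(k)}(t) = 0`. -/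
def IsLinearizableTo {n m : ℕ} (r : ℕ) (f : RatFun n m) (h : Fin m → ℂ × ℂ → ℂ)
    (D : Set (ℂ × ℂ)) : Prop :=
  ∃ (U : Set (ℂ × ℂ)) (φ ψ : ℂ × ℂ → ℂ) (a : Fin r → ℂ → ℂ),
    U ⊆ D ∧ IsPointTransformation φ ψ U ∧ (∀ k, AnalyticOnNhd ℂ (a k) (ψ '' U)) ∧
    MapsEquation f h a φ ψ U

/-- Linearizability: the target is an arbitrary linear homogeneous equation
`u^{(n)}(t) + ∑_{k=0}^{n-1} a_k(t) u^{(k)}(t) = 0`. -/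
def IsLinearizable {n m : ℕ} (f : RatFun n m) (h : Fin m → ℂ × ℂ → ℂ) (D : Set (ℂ × ℂ)) : Prop :=
  IsLinearizableTo n f h D

/-- Linearizability with the target in normal form: `u''(t) = 0` if `n = 2`, and the
Laguerre–Forsyth form `u^{(n)}(t) + ∑_{k=0}^{n-3} a_k(t) u^{(k)}(t) = 0` if `n ≥ 3`. -/
def IsLinearizableToNormalForm {n m : ℕ} (f : RatFun n m) (h : Fin m → ℂ × ℂ → ℂ)
    (D : Set (ℂ × ℂ)) : Prop :=
  IsLinearizableTo (n - 2) f h D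

/-! ### Differential polynomials and differential systems -/

/-- The functions of `(x, y)` in the linearizing differential system: the unknowns `φ`, `ψ` and
`a_0, …, a_{n-3}` (none of the latter if `n = 2`), and the given functions `h`. -/
inductive DepVar (n m : ℕ) : Type
  | phi : DepVar n m
  | psi : DepVar n m
  | a (k : Fin (n - 2)) : DepVar n m
  | h (i : Fin m) : DepVar n m

/-- The variables of differential polynomials: `x`, `y`, and the partial derivatives
`jet v i j = ∂_x^i ∂_y^j v`. -/
inductive Indet (n m : ℕ) : Type
  | x : Indet n m
  | y : Indet n m
  | jet (v : DepVar n m) (i j : ℕ) : Indet n m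

/-- Differential polynomials in `φ, ψ, a_k, h_i`, with coefficients in `ℂ[x, y]`. -/
abbrev DiffPoly (n m : ℕ) : Type := MvPolynomial (Indet n m) ℂ

/-- The differential polynomial `∂_x^i ∂_y^j v`. -/
def DiffPoly.jet {n m : ℕ} (v : DepVar n m) (i j : ℕ) : DiffPoly n m :=
  MvPolynomial.X (.jet v i j)

/-- The values of the variables at the point `p`, where the functions `w` are substituted for the
differential indeterminates. -/
def Indet.value {n m : ℕ} (w : DepVar n m → ℂ × ℂ → ℂ) (p : ℂ × ℂ) : Indet n m → ℂ
  | .x => p.1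
  | .y => p.2
  | .jet v i j => (pdx^[i] (pdy^[j] (w v))) p

/-- A differential system: equations `g = 0` and inequations `g ≠ 0`. -/
structure DiffSystem (n m : ℕ) where
  eqs : Set (DiffPoly n m)
  ineqs : Set (DiffPoly n m)

/-- The functions `w` satisfy the differential system on `U`. -/
structure DiffSystem.IsSolutionOn {n m : ℕ} (S : DiffSystem n m) (w : DepVar n m → ℂ × ℂ → ℂ)
    (U : Set (ℂ × ℂ)) : Prop where
  analytic : ∀ v, AnalyticOnNhd ℂ (w v) U
  eqs : ∀ g ∈ S.eqs, ∀ p ∈ U, MvPolynomial.eval (Indet.value w p) g = 0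
  ineqs : ∀ g ∈ S.ineqs, ∀ p ∈ U, MvPolynomial.eval (Indet.value w p) g ≠ 0

/-- The functions `φ`, `ψ`, `a_k`, `h_i` as values of the differential indeterminates. -/
def assign {n m : ℕ} (φ ψ : ℂ × ℂ → ℂ) (a : Fin (n - 2) → ℂ × ℂ → ℂ) (h : Fin m → ℂ × ℂ → ℂ) :
    DepVar n m → ℂ × ℂ → ℂ
  | .phi => φ
  | .psi => ψ
  | .a k => a k
  | .h i => h i

/-- The system, in which the functions `h` are given on `D`, has a solution `φ, ψ, a_k` on some
nonempty open subset of `D`. -/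
def DiffSystem.IsConsistent {n m : ℕ} (S : DiffSystem n m) (h : Fin m → ℂ × ℂ → ℂ)
    (D : Set (ℂ × ℂ)) : Prop :=
  ∃ (U : Set (ℂ × ℂ)) (φ ψ : ℂ × ℂ → ℂ) (a : Fin (n - 2) → ℂ × ℂ → ℂ),
    U ⊆ D ∧ IsOpen U ∧ U.Nonempty ∧ S.IsSolutionOn (assign φ ψ a h) U

/-! ### The linearizing differential system -/

/-- Polynomials in the variables of differential polynomials and in `y', y'', …`; the variable
`Sum.inl k` stands for `y^{(k+1)}`. -/
abbrev JetPoly (n m : ℕ) : Type := MvPolynomial (ℕ ⊕ Indet n m) ℂ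

namespace JetPoly

variable {n m : ℕ}

/-- The derivative `y^{(k+1)}`. -/
def dy (k : ℕ) : JetPoly n m := MvPolynomial.X (Sum.inl k)

/-- The partial derivative `∂_x^i ∂_y^j v`. -/
def jet (v : DepVar n m) (i j : ℕ) : JetPoly n m := MvPolynomial.X (Sum.inr (.jet v i j))

/-- The total derivative `D_x = ∂_x + y' ∂_y + y'' ∂_{y'} + ⋯`. -/
def totalDeriv : Derivation ℂ (JetPoly n m) (JetPoly n m) :=
  MvPolynomial.mkDerivation ℂ fun
    | .inl k => dy (k + 1)
    | .inr .x => 1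
    | .inr .y => dy 0
    | .inr (.jet v i j) => jet v (i + 1) j + jet v i (j + 1) * dy 0

/-- The Jacobian `J = φ_x ψ_y - φ_y ψ_x`. -/
def jacobian : JetPoly n m :=
  jet .phi 1 0 * jet .psi 0 1 - jet .phi 0 1 * jet .psi 1 0

/-- `δ = D_x ψ = ψ_x + ψ_y y'`. -/
def delta : JetPoly n m := jet .psi 1 0 + jet .psi 0 1 * dy 0

/-- The numerators of the derivatives of `u` with respect to `t` in terms of `x`, `y` and the
derivatives of `y`: `u^{(k+1)}(t) = derivNumerator k / δ^{2k+1}`, by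
`u' = (φ_x + φ_y y') / δ` and `u^{(k+1)} = D_x(u^{(k)}) / δ`. -/
def derivNumerator : ℕ → JetPoly n m
  | 0 => jet .phi 1 0 + jet .phi 0 1 * dy 0
  | k + 1 => delta * totalDeriv (derivNumerator k) -
      (2 * (k : JetPoly n m) + 1) * derivNumerator k * totalDeriv delta

/-- The polynomial `δ^{2n-1} u^{(k)}(t)`, for `k ≤ n`. -/
def scaledDeriv : ℕ → JetPoly n m
  | 0 => delta ^ (2 * n - 1) * jet .phi 0 0
  | k + 1 => delta ^ (2 * (n - (k + 1))) * derivNumerator k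

/-- `δ^{2n-1} (u^{(n)} + ∑_{k=0}^{n-3} a_k u^{(k)})`, the transformed left-hand side of the normal
form, with denominators cleared. -/
def transformedNormalForm : JetPoly n m :=
  scaledDeriv n + ∑ k : Fin (n - 2), jet (.a k) 0 0 * scaledDeriv (k : ℕ)

/-- The polynomial `R` in `y', …, y^{(n-1)}`. As `y^{(n)}` enters the transformed normal form
through the term `-J δ^{n-2} y^{(n)}` only, the latter equals `-(J δ^{n-2} y^{(n)} + R)`, and the
transformed equation, solved for `y^{(n)}`, is `y^{(n)} + R / (J δ^{n-2}) = 0`. -/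
def remainder : JetPoly n m :=
  -(transformedNormalForm + jacobian * delta ^ (n - 2) * dy (n - 1))

/-- The arguments of the equation as variables of `JetPoly`. -/
def ofEqVar : EqVar n m → ℕ ⊕ Indet n m
  | .x => .inr .x
  | .y => .inr .y
  | .h i => .inr (.jet (.h i) 0 0)
  | .dy k => .inl k

/-- The polynomial `R N - J M (ψ_x + ψ_y y')^{n-2}`, where `f = M / N`. -/
def linearizationPoly (f : RatFun n m) : JetPoly n m :=
  remainder * MvPolynomial.rename ofEqVar (denominator f) -
    jacobian * MvPolynomial.rename ofEqVar (numerator f) * delta ^ (n - 2)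

/-- The coefficients of a polynomial with respect to the variables `y', y'', …`. -/
def coeffs (T : JetPoly n m) : Set (DiffPoly n m) :=
  {c | ∃ d : ℕ →₀ ℕ,
    c = MvPolynomial.coeff d (MvPolynomial.sumAlgEquiv ℂ ℕ (Indet n m) T)}

end JetPoly

/-- The linearizing differential system of `y^{(n)} + f = 0`. -/
def linearizingSystem {n m : ℕ} (f : RatFun n m) : DiffSystem n m where
  eqs := JetPoly.coeffs (JetPoly.linearizationPoly f) ∪
    {g | ∃ k : Fin (n - 2),
      g = DiffPoly.jet .psi 0 1 * DiffPoly.jet (.a k) 1 0 -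
        DiffPoly.jet .psi 1 0 * DiffPoly.jet (.a k) 0 1}
  ineqs := {DiffPoly.jet .phi 1 0 * DiffPoly.jet .psi 0 1 -
    DiffPoly.jet .phi 0 1 * DiffPoly.jet .psi 1 0}

end LinODE

end

/-! Let the graph of `y` be mapped to the graph of `u`. Applying `D_x / δ` repeatedly expresses
`u^{(k)}` at `ψ(x, y(x))` through the jet of `y`, and gives `δ^{2n-1} (u^{(n)} + ∑ a_k u^{(k)}) =
-(J δ^{n-2} y^{(n)} + R)`, where `R` has order at most `n - 1`. Moreover `δ ≠ 0` along such a graph: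
`D_x φ = u' δ`, so `δ = 0` would put `(1, y')` into the kernel of the Jacobian matrix.

From the system to a linearization: the coefficient equations say `R N = J M δ^{n-2}` at every jet,
so the transformed left-hand side is a nonzero multiple of `y^{(n)} + M / N`, and the two equations
are equivalent point by point (`odeAt_iff_linearOdeAt`). The other equations say that each `a_k` has
vanishing Jacobian with `ψ`; in the local coordinates `(φ, ψ)` it depends on `ψ` only
(`exists_eq_comp`).

From a normal form to the system: a jet `(y', …, y^{(n-1)})` at a point of `U` with `N ≠ 0` and `δ ≠
0` is realised by a solution. Transform it into initial values for `u`, solve the linear equation,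
and pull the solution back by the implicit function theorem. At the base point both equations hold,
which forces `R N = J M δ^{n-2}` at this jet. At a point over which `N` is not the zero polynomial,
the excluded jets are removed because a polynomial ring has no zero divisors, and the identity
theorem provides a nonempty open set of such points.

From a linear equation to a normal form: `u = g v` with a suitable `g` removes the term of order `n
- 1`. Then `u = w^{n-1} v`, `ds = dt / w^2`, with `w'' + q w = 0` and `q` a constant multiple of
`a_{n-2}`, removes the term of order `n - 2` without bringing back the previous one. Both steps need
only local holomorphic solutions of linear equations. -/

namespace LinODE

section

open MvPolynomial

/-! ### Polynomials in jet variables -/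

namespace JetPoly

variable {n m : ℕ}

/-- The value of a polynomial, where `y^{(k+1)}` takes the value `Z k`. -/
abbrev evalJet (Z : ℕ → ℂ) (v : Indet n m → ℂ) : JetPoly n m →+* ℂ := eval (Sum.elim Z v)

theorem eval_map_sumAlgEquiv (Z : ℕ → ℂ) (v : Indet n m → ℂ) (T : JetPoly n m) :
    eval Z (map (eval v) (sumAlgEquiv ℂ ℕ (Indet n m) T)) = evalJet Z v T := by
  induction T using MvPolynomial.induction_on with
  | C a => simp
  | add p q hp hq => simp only [map_add, hp, hq]
  | mul_X p i hp =>
    rw [map_mul, map_mul, map_mul, hp, map_mul]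
    rcases i with i | i <;> simp

/-- A polynomial over an infinite field is zero as soon as it vanishes as a function. Hence the
coefficient equations at a point amount to vanishing at every jet over that point. -/
theorem coeffs_vanish_iff (v : Indet n m → ℂ) (T : JetPoly n m) :
    (∀ c ∈ coeffs T, eval v c = 0) ↔ ∀ Z, evalJet Z v T = 0 := by
  have h : (∀ c ∈ coeffs T, eval v c = 0) ↔
      map (eval v) (sumAlgEquiv ℂ ℕ (Indet n m) T) = 0 := by
    rw [MvPolynomial.ext_iff]
    simp [coeffs, coeff_map]
  rw [h]
  constructor
  · intro h0 Z
    rw [← eval_map_sumAlgEquiv, h0, map_zero]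
  · intro h0
    refine MvPolynomial.funext fun Z => ?_
    rw [eval_map_sumAlgEquiv, h0, map_zero]

/-- A polynomial vanishes at all jets over `v` if it does wherever another one, not vanishing
identically there, is nonzero. -/
theorem evalJet_eq_zero_of_ne_zero (v : Indet n m → ℂ) (T S : JetPoly n m)
    (hS : ∃ Z, evalJet Z v S ≠ 0) (hT : ∀ Z, evalJet Z v S ≠ 0 → evalJet Z v T = 0) (Z : ℕ → ℂ) :
    evalJet Z v T = 0 := by
  -- The product vanishes as a function, hence as a polynomial in `y', y'', …`, and one of its
  -- factors is zero.
  have key : map (eval v) (sumAlgEquiv ℂ ℕ (Indet n m) T) *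
      map (eval v) (sumAlgEquiv ℂ ℕ (Indet n m) S) = 0 := by
    refine MvPolynomial.funext fun Z => ?_
    rw [map_mul, eval_map_sumAlgEquiv, eval_map_sumAlgEquiv, map_zero, mul_eq_zero]
    by_cases h : evalJet Z v S = 0
    · exact Or.inr h
    · exact Or.inl (hT Z h)
  rcases mul_eq_zero.1 key with h | h
  · rw [← eval_map_sumAlgEquiv, h, map_zero]
  · obtain ⟨Z', hZ'⟩ := hS
    rw [← eval_map_sumAlgEquiv, h, map_zero] at hZ'
    exact absurd rfl hZ'

/-! ### Order of polynomials in the derivatives of `y` -/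

/-- Polynomials in `y', …, y^{(k)}` and the variables of differential polynomials. -/
noncomputable def lowOrder (k : ℕ) : Subalgebra ℂ (JetPoly n m) :=
  supported ℂ {i | ∀ j, i = Sum.inl j → j < k}

theorem lowOrder_mono {k l : ℕ} (h : k ≤ l) : lowOrder (n := n) (m := m) k ≤ lowOrder l :=
  supported_mono fun _ hi j hj => (hi j hj).trans_le h

theorem dy_mem {j k : ℕ} (h : j < k) : dy j ∈ lowOrder (n := n) (m := m) k :=
  Algebra.subset_adjoin ⟨Sum.inl j, fun i hi => by cases hi; exact h, rfl⟩

theorem inr_mem (i : Indet n m) (k : ℕ) :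
    (X (Sum.inr i) : JetPoly n m) ∈ lowOrder (n := n) (m := m) k :=
  Algebra.subset_adjoin ⟨Sum.inr i, fun j hj => (by cases hj), rfl⟩

theorem jet_mem (v : DepVar n m) (i j k : ℕ) : jet v i j ∈ lowOrder (n := n) (m := m) k :=
  inr_mem _ _

theorem jacobian_mem (k : ℕ) : jacobian ∈ lowOrder (n := n) (m := m) k :=
  sub_mem (mul_mem (jet_mem _ _ _ _) (jet_mem _ _ _ _))
    (mul_mem (jet_mem _ _ _ _) (jet_mem _ _ _ _))

theorem delta_mem {k : ℕ} (hk : 1 ≤ k) : delta ∈ lowOrder (n := n) (m := m) k :=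
  add_mem (jet_mem _ _ _ _) (mul_mem (jet_mem _ _ _ _) (dy_mem hk))

theorem totalDeriv_mem {k : ℕ} {P : JetPoly n m} (hP : P ∈ lowOrder k) :
    totalDeriv P ∈ lowOrder (k + 1) := by
  induction hP using Algebra.adjoin_induction with
  | mem x hx =>
    obtain ⟨i, hi, rfl⟩ := hx
    rw [totalDeriv, mkDerivation_X]
    rcases i with i | i | i | ⟨v, i, j⟩
    · exact dy_mem (Nat.succ_lt_succ (hi i rfl))
    · exact one_mem _
    · exact dy_mem (Nat.succ_pos k)
    · exact add_mem (jet_mem _ _ _ _) (mul_mem (jet_mem _ _ _ _) (dy_mem (Nat.succ_pos k)))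
  | algebraMap r =>
    rw [Derivation.map_algebraMap]
    exact zero_mem _
  | add x y hx hy hx' hy' =>
    rw [map_add]
    exact add_mem hx' hy'
  | mul x y hx hy hx' hy' =>
    have hm : lowOrder (n := n) (m := m) k ≤ lowOrder (k + 1) := lowOrder_mono (Nat.le_succ k)
    rw [Derivation.leibniz, smul_eq_mul, smul_eq_mul]
    exact add_mem (mul_mem (hm hx) hy') (mul_mem (hm hy) hx')

theorem totalDeriv_dy (k : ℕ) : totalDeriv (dy k : JetPoly n m) = dy (k + 1) :=
  mkDerivation_X _ _ _

theorem totalDeriv_jet (v : DepVar n m) (i j : ℕ) :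
    totalDeriv (jet v i j : JetPoly n m) = jet v (i + 1) j + jet v i (j + 1) * dy 0 :=
  mkDerivation_X _ _ _

/-- The highest derivative enters `derivNumerator (k + 1)` linearly. -/
theorem derivNumerator_succ_add_mem (k : ℕ) :
    derivNumerator (k + 1) + jacobian * delta ^ k * dy (k + 1) ∈
      lowOrder (n := n) (m := m) (k + 1) := by
  induction k with
  | zero =>
    have h : derivNumerator 1 + jacobian * delta ^ 0 * dy 1 =
        (delta * (jet .phi 2 0 + jet .phi 1 1 * dy 0 + dy 0 * (jet .phi 1 1 + jet .phi 0 2 * dy 0))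
          - (jet .phi 1 0 + jet .phi 0 1 * dy 0) *
            (jet .psi 2 0 + jet .psi 1 1 * dy 0 + dy 0 * (jet .psi 1 1 + jet .psi 0 2 * dy 0)) :
          JetPoly n m) := by
      simp only [derivNumerator, delta, jacobian, map_add, Derivation.leibniz, totalDeriv_jet,
        totalDeriv_dy, smul_eq_mul]
      push_cast
      ring
    rw [zero_add, h]
    have hd := dy_mem (n := n) (m := m) (Nat.zero_lt_one)
    have hj := fun (v : DepVar n m) (i j : ℕ) => jet_mem v i j 1
    exact sub_mem (mul_mem (delta_mem le_rfl) (add_mem (add_mem (hj _ _ _)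
      (mul_mem (hj _ _ _) hd)) (mul_mem hd (add_mem (hj _ _ _) (mul_mem (hj _ _ _) hd)))))
      (mul_mem (add_mem (hj _ _ _) (mul_mem (hj _ _ _) hd)) (add_mem (add_mem (hj _ _ _)
      (mul_mem (hj _ _ _) hd)) (mul_mem hd (add_mem (hj _ _ _) (mul_mem (hj _ _ _) hd)))))
  | succ k ih =>
    set Q : JetPoly n m := derivNumerator (k + 1) + jacobian * delta ^ k * dy (k + 1) with hQ
    have hN : derivNumerator (k + 1) = Q - jacobian * delta ^ k * dy (k + 1) := by
      rw [hQ]; ring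
    -- The only term of top order in the recursion comes from `totalDeriv` acting on the factor `dy
    -- (k + 1)`. It equals `-jacobian * delta ^ (k + 1) * dy (k + 2)` and cancels against the added
    -- term.
    have h : derivNumerator (k + 1 + 1) + jacobian * delta ^ (k + 1) * dy (k + 1 + 1) =
        delta * totalDeriv Q - delta * (dy (k + 1) * totalDeriv (jacobian * delta ^ k)) -
          (2 * ((k + 1 : ℕ) : JetPoly n m) + 1) * (Q - jacobian * delta ^ k * dy (k + 1)) *
            totalDeriv delta := by
      rw [derivNumerator, hN, map_sub, Derivation.leibniz _ (jacobian * delta ^ k),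
        totalDeriv_dy, smul_eq_mul, smul_eq_mul]
      ring
    rw [h]
    have hd : delta ∈ lowOrder (n := n) (m := m) (k + 1 + 1) := delta_mem (by omega)
    have hJ : jacobian * delta ^ k ∈ lowOrder (n := n) (m := m) (k + 1) :=
      mul_mem (jacobian_mem _) (pow_mem (delta_mem (by omega)) _)
    have hm : lowOrder (n := n) (m := m) (k + 1) ≤ lowOrder (k + 1 + 1) :=
      lowOrder_mono (Nat.le_succ _)
    have hy := dy_mem (n := n) (m := m) (Nat.lt_succ_self (k + 1))
    refine sub_mem (sub_mem (mul_mem hd (totalDeriv_mem ih)) (mul_mem hd (mul_mem hy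
      (totalDeriv_mem hJ)))) (mul_mem (mul_mem ?_ (sub_mem (hm ih) (mul_mem (hm hJ) hy)))
      (totalDeriv_mem (delta_mem (by omega))))
    exact add_mem (mul_mem (natCast_mem _ 2) (natCast_mem _ _)) (one_mem _)

theorem derivNumerator_mem (k : ℕ) : derivNumerator k ∈ lowOrder (n := n) (m := m) (k + 1) := by
  rcases k with _ | k
  · exact add_mem (jet_mem _ _ _ _) (mul_mem (jet_mem _ _ _ _) (dy_mem Nat.zero_lt_one))
  · have h : derivNumerator (k + 1) = (derivNumerator (k + 1) +
        jacobian * delta ^ k * dy (k + 1)) - jacobian * delta ^ k * (dy (k + 1) : JetPoly n m) := by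
      ring
    rw [h]
    exact sub_mem (lowOrder_mono (Nat.le_succ _) (derivNumerator_succ_add_mem k))
      (mul_mem (mul_mem (jacobian_mem _) (pow_mem (delta_mem (by omega)) _))
        (dy_mem (Nat.lt_succ_self _)))

theorem scaledDeriv_mem {k l : ℕ} (hl : 1 ≤ l) (h : k ≤ l) :
    scaledDeriv k ∈ lowOrder (n := n) (m := m) l := by
  rcases k with _ | k
  · exact mul_mem (pow_mem (delta_mem hl) _) (jet_mem _ _ _ _)
  · exact mul_mem (pow_mem (delta_mem hl) _) (lowOrder_mono h (derivNumerator_mem k))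

/-- The term `jacobian * delta ^ (n - 2) * dy (n - 1)` in the definition cancels the sole occurrence
of `y^{(n)}`, which sits in `derivNumerator (n - 1)`. -/
theorem remainder_mem (hn : 2 ≤ n) : remainder ∈ lowOrder (n := n) (m := m) (n - 1) := by
  obtain ⟨k, rfl⟩ : ∃ k, n = k + 2 := ⟨n - 2, by omega⟩
  have h : (remainder : JetPoly (k + 2) m) =
      -((derivNumerator (k + 1) + jacobian * delta ^ k * dy (k + 1)) +
        ∑ i : Fin (k + 2 - 2), jet (.a i) 0 0 * scaledDeriv (i : ℕ)) := by
    simp only [remainder, transformedNormalForm, scaledDeriv]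
    simp only [Nat.sub_self, Nat.mul_zero, pow_zero, one_mul]
    simp only [Nat.add_sub_cancel, show k + 2 - 1 = k + 1 from rfl]
    ring
  rw [h]
  exact neg_mem (add_mem (derivNumerator_succ_add_mem k) (sum_mem fun i _ =>
    mul_mem (jet_mem _ _ _ _) (scaledDeriv_mem (by omega) (by omega))))

/-- Used to pass between a prescribed jet and the jet of an actual function that agrees with it only
up to a finite order. -/
theorem evalJet_congr {k : ℕ} {P : JetPoly n m} (hP : P ∈ lowOrder k) (v : Indet n m → ℂ)
    {Z Z' : ℕ → ℂ} (h : ∀ j < k, Z j = Z' j) : evalJet Z v P = evalJet Z' v P := by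
  refine eval₂Hom_congr' rfl (fun i hi _ => ?_) rfl
  rcases i with i | i
  · exact h i (mem_supported.1 hP hi i rfl)
  · rfl

theorem evalJet_dy (Z : ℕ → ℂ) (v : Indet n m → ℂ) (k : ℕ) : evalJet Z v (dy k) = Z k := by
  simp [evalJet, dy]

theorem evalJet_jet (Z : ℕ → ℂ) (v : Indet n m → ℂ) (w : DepVar n m) (i j : ℕ) :
    evalJet Z v (jet w i j) = v (.jet w i j) := by
  simp [evalJet, jet]

theorem evalJet_rename_ofEqVar (Z : ℕ → ℂ) (w : DepVar n m → ℂ × ℂ → ℂ) (p : ℂ × ℂ)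
    (g : MvPolynomial (EqVar n m) ℂ) :
    evalJet Z (Indet.value w p) (rename ofEqVar g) =
      evalAt (fun i => w (.h i)) p (fun k => Z k) g := by
  rw [evalJet, eval_rename, evalAt]
  congr 2
  funext i
  cases i <;> rfl

theorem rename_ofEqVar_mem (g : MvPolynomial (EqVar n m) ℂ) :
    rename ofEqVar g ∈ lowOrder (n := n) (m := m) (n - 1) := by
  refine mem_supported.2 fun i hi j hj => ?_
  classical
  obtain ⟨e, -, rfl⟩ := Finset.mem_image.1 (vars_rename ofEqVar g hi)
  rcases e with _ | _ | _ | k <;> cases hj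
  exact k.2

theorem linearizationPoly_mem (hn : 2 ≤ n) (f : RatFun n m) :
    linearizationPoly f ∈ lowOrder (n := n) (m := m) (n - 1) :=
  sub_mem (mul_mem (remainder_mem hn) (rename_ofEqVar_mem _))
    (mul_mem (mul_mem (jacobian_mem _) (rename_ofEqVar_mem _))
      (pow_mem (delta_mem (by omega)) _))

end JetPoly

end

section

open Filter Topology

/-! ### Partial derivatives of functions of two variables -/

theorem hasDerivAt_comp_curve {F : ℂ × ℂ → ℂ} {X Y : ℂ → ℂ} {X' Y' s : ℂ}
    (hF : DifferentiableAt ℂ F (X s, Y s)) (hX : HasDerivAt X X' s) (hY : HasDerivAt Y Y' s) :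
    HasDerivAt (fun s => F (X s, Y s))
      (fderiv ℂ F (X s, Y s) (X', Y')) s :=
  HasFDerivAt.comp_hasDerivAt (f := fun s => (X s, Y s)) s hF.hasFDerivAt (hX.prodMk hY)

theorem pdx_eq_fderiv {F : ℂ × ℂ → ℂ} {p : ℂ × ℂ} (hF : DifferentiableAt ℂ F p) :
    pdx F p = fderiv ℂ F p (1, 0) :=
  (hasDerivAt_comp_curve (X := fun s => s) (Y := fun _ => p.2) hF (hasDerivAt_id _)
    (hasDerivAt_const _ _)).deriv

theorem pdy_eq_fderiv {F : ℂ × ℂ → ℂ} {p : ℂ × ℂ} (hF : DifferentiableAt ℂ F p) :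
    pdy F p = fderiv ℂ F p (0, 1) :=
  (hasDerivAt_comp_curve (X := fun _ => p.1) (Y := fun s => s) hF (hasDerivAt_const _ _)
    (hasDerivAt_id _)).deriv

theorem fderiv_apply_eq {F : ℂ × ℂ → ℂ} {p : ℂ × ℂ} (hF : DifferentiableAt ℂ F p) (a b : ℂ) :
    fderiv ℂ F p (a, b) = pdx F p * a + pdy F p * b := by
  have h : ((a, b) : ℂ × ℂ) = a • ((1, 0) : ℂ × ℂ) + b • ((0, 1) : ℂ × ℂ) := by simp
  rw [h, map_add, map_smul, map_smul, pdx_eq_fderiv hF, pdy_eq_fderiv hF, smul_eq_mul,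
    smul_eq_mul, mul_comm a, mul_comm b]

/-- The chain rule along a curve. -/
theorem hasDerivAt_comp_pair {F : ℂ × ℂ → ℂ} {X Y : ℂ → ℂ} {X' Y' s : ℂ}
    (hF : DifferentiableAt ℂ F (X s, Y s)) (hX : HasDerivAt X X' s) (hY : HasDerivAt Y Y' s) :
    HasDerivAt (fun s => F (X s, Y s))
      (pdx F (X s, Y s) * X' + pdy F (X s, Y s) * Y') s := by
  rw [← fderiv_apply_eq hF]
  exact hasDerivAt_comp_curve hF hX hY

theorem pdx_congr {F G : ℂ × ℂ → ℂ} {p : ℂ × ℂ} (h : F =ᶠ[𝓝 p] G) : pdx F =ᶠ[𝓝 p] pdx G := by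
  filter_upwards [h.eventually_nhds] with q hq
  have hc : Tendsto (fun s => (s, q.2)) (𝓝 q.1) (𝓝 q) := by
    exact (continuous_id.prodMk continuous_const).tendsto' _ _ rfl
  exact EventuallyEq.deriv_eq (hc.eventually hq)

theorem pdy_congr {F G : ℂ × ℂ → ℂ} {p : ℂ × ℂ} (h : F =ᶠ[𝓝 p] G) : pdy F =ᶠ[𝓝 p] pdy G := by
  filter_upwards [h.eventually_nhds] with q hq
  have hc : Tendsto (fun s => (q.1, s)) (𝓝 q.2) (𝓝 q) := by
    exact (continuous_const.prodMk continuous_id).tendsto' _ _ rfl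
  exact EventuallyEq.deriv_eq (hc.eventually hq)

theorem pdx_eventuallyEq {F : ℂ × ℂ → ℂ} {p : ℂ × ℂ} (hF : AnalyticAt ℂ F p) :
    pdx F =ᶠ[𝓝 p] fun q => fderiv ℂ F q (1, 0) :=
  hF.eventually_analyticAt.mono fun _ hq => pdx_eq_fderiv hq.differentiableAt

theorem pdy_eventuallyEq {F : ℂ × ℂ → ℂ} {p : ℂ × ℂ} (hF : AnalyticAt ℂ F p) :
    pdy F =ᶠ[𝓝 p] fun q => fderiv ℂ F q (0, 1) :=
  hF.eventually_analyticAt.mono fun _ hq => pdy_eq_fderiv hq.differentiableAt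

theorem analyticAt_pdx {F : ℂ × ℂ → ℂ} {p : ℂ × ℂ} (hF : AnalyticAt ℂ F p) :
    AnalyticAt ℂ (pdx F) p :=
  (((ContinuousLinearMap.apply ℂ ℂ ((1, 0) : ℂ × ℂ)).analyticAt _).comp hF.fderiv).congr
    (pdx_eventuallyEq hF).symm

theorem analyticAt_pdy {F : ℂ × ℂ → ℂ} {p : ℂ × ℂ} (hF : AnalyticAt ℂ F p) :
    AnalyticAt ℂ (pdy F) p :=
  (((ContinuousLinearMap.apply ℂ ℂ ((0, 1) : ℂ × ℂ)).analyticAt _).comp hF.fderiv).congr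
    (pdy_eventuallyEq hF).symm

theorem analyticAt_iterate_pdx {F : ℂ × ℂ → ℂ} {p : ℂ × ℂ} (hF : AnalyticAt ℂ F p) (i : ℕ) :
    AnalyticAt ℂ (pdx^[i] F) p := by
  induction i with
  | zero => exact hF
  | succ i ih => rw [Function.iterate_succ_apply']; exact analyticAt_pdx ih

theorem analyticAt_iterate_pdy {F : ℂ × ℂ → ℂ} {p : ℂ × ℂ} (hF : AnalyticAt ℂ F p) (i : ℕ) :
    AnalyticAt ℂ (pdy^[i] F) p := by
  induction i with
  | zero => exact hF
  | succ i ih => rw [Function.iterate_succ_apply']; exact analyticAt_pdy ih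

theorem pdx_pdy_comm {F : ℂ × ℂ → ℂ} {p : ℂ × ℂ} (hF : AnalyticAt ℂ F p) :
    pdx (pdy F) p = pdy (pdx F) p := by
  have hx := (pdx_congr (pdy_eventuallyEq hF)).eq_of_nhds
  have hy := (pdy_congr (pdx_eventuallyEq hF)).eq_of_nhds
  have hd : DifferentiableAt ℂ (fderiv ℂ F) p := hF.fderiv.differentiableAt
  have hs : IsSymmSndFDerivAt ℂ F p :=
    ContDiffAt.isSymmSndFDerivAt (n := ⊤) hF.contDiffAt le_top
  rw [hx, hy, pdx_eq_fderiv (hd.clm_apply (differentiableAt_const _)),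
    pdy_eq_fderiv (hd.clm_apply (differentiableAt_const _)),
    fderiv_clm_apply hd (differentiableAt_const _), fderiv_clm_apply hd (differentiableAt_const _)]
  simp [hs.eq (1, 0) (0, 1)]

theorem iterate_pdx_pdy_comm {F : ℂ × ℂ → ℂ} {p : ℂ × ℂ} (hF : AnalyticAt ℂ F p) (i : ℕ) :
    pdx^[i] (pdy F) =ᶠ[𝓝 p] pdy (pdx^[i] F) := by
  induction i with
  | zero => rfl
  | succ i ih =>
    rw [Function.iterate_succ_apply', Function.iterate_succ_apply']
    exact (pdx_congr ih).trans
      ((analyticAt_iterate_pdx hF i).eventually_analyticAt.mono fun q hq => pdx_pdy_comm hq)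

/-! ### Local inverses and implicit functions -/

/-- A pair of analytic functions with nonvanishing Jacobian is locally invertible. -/
theorem exists_local_inverse {φ ψ : ℂ × ℂ → ℂ} {p : ℂ × ℂ} (hφ : AnalyticAt ℂ φ p)
    (hψ : AnalyticAt ℂ ψ p) (hJ : pdx φ p * pdy ψ p - pdy φ p * pdx ψ p ≠ 0) :
    ∃ e : OpenPartialHomeomorph (ℂ × ℂ) (ℂ × ℂ), p ∈ e.source ∧ (∀ q, e q = (φ q, ψ q)) ∧
      AnalyticAt ℂ e.symm (e p) := by
  have hΦ : AnalyticAt ℂ (fun q => (φ q, ψ q)) p := hφ.prod hψ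
  have hL : fderiv ℂ (fun q => (φ q, ψ q)) p = (fderiv ℂ φ p).prod (fderiv ℂ ψ p) :=
    hφ.differentiableAt.fderiv_prodMk hψ.differentiableAt
  set L := fderiv ℂ (fun q => (φ q, ψ q)) p with hLdef
  have hinj : Function.Injective (L : ℂ × ℂ →ₗ[ℂ] ℂ × ℂ) := by
    refine (injective_iff_map_eq_zero _).2 fun v hv => ?_
    have hv' : L v = 0 := hv
    obtain ⟨a, b⟩ := v
    rw [hL, ContinuousLinearMap.prod_apply, fderiv_apply_eq hφ.differentiableAt,
      fderiv_apply_eq hψ.differentiableAt, Prod.mk_eq_zero] at hv'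
    obtain ⟨h1, h2⟩ := hv'
    -- Cramer's rule: `J` annihilates both components of a kernel vector.
    have ha : (pdx φ p * pdy ψ p - pdy φ p * pdx ψ p) * a = 0 := by
      linear_combination pdy ψ p * h1 - pdy φ p * h2
    have hb : (pdx φ p * pdy ψ p - pdy φ p * pdx ψ p) * b = 0 := by
      linear_combination pdx φ p * h2 - pdx ψ p * h1
    rw [(mul_eq_zero.1 ha).resolve_left hJ, (mul_eq_zero.1 hb).resolve_left hJ]
    rfl
  let E : (ℂ × ℂ) ≃L[ℂ] ℂ × ℂ := (LinearEquiv.ofInjectiveEndo _ hinj).toContinuousLinearEquiv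
  have hE : (E : ℂ × ℂ →L[ℂ] ℂ × ℂ) = L := by
    ext <;> rfl
  have hs : HasStrictFDerivAt (fun q => (φ q, ψ q)) (E : ℂ × ℂ →L[ℂ] ℂ × ℂ) p := by
    rw [hE]
    exact hΦ.hasStrictFDerivAt
  refine ⟨hs.toOpenPartialHomeomorph _, hs.mem_toOpenPartialHomeomorph_source, fun q => rfl, ?_⟩
  exact OpenPartialHomeomorph.analyticAt_symm' (i := E) _ hs.mem_toOpenPartialHomeomorph_source hΦ
    hs.hasFDerivAt.fderiv

/-- The implicit function theorem. -/
theorem exists_implicit_function {F : ℂ × ℂ → ℂ} {x₀ y₀ : ℂ} (hF : AnalyticAt ℂ F (x₀, y₀))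
    (h0 : F (x₀, y₀) = 0) (hy : pdy F (x₀, y₀) ≠ 0) :
    ∃ y : ℂ → ℂ, AnalyticAt ℂ y x₀ ∧ y x₀ = y₀ ∧ ∀ᶠ x in 𝓝 x₀, F (x, y x) = 0 := by
  -- Invert `(x, y) ↦ (F(x, y), x)`, whose Jacobian is `-F_y`; the implicit function is the second
  -- component of the preimage of `(0, x)`.
  have hfst : AnalyticAt ℂ (fun q : ℂ × ℂ => q.1) (x₀, y₀) := analyticAt_fst
  have hJ : pdx F (x₀, y₀) * pdy (fun q : ℂ × ℂ => q.1) (x₀, y₀) -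
      pdy F (x₀, y₀) * pdx (fun q : ℂ × ℂ => q.1) (x₀, y₀) ≠ 0 := by
    have h1 : pdy (fun q : ℂ × ℂ => q.1) (x₀, y₀) = 0 := by simp [pdy]
    have h2 : pdx (fun q : ℂ × ℂ => q.1) (x₀, y₀) = 1 := by simp [pdx]
    rw [h1, h2]
    simpa using hy
  obtain ⟨e, hp, he, hes⟩ := exists_local_inverse hF hfst hJ
  have hep : e (x₀, y₀) = (0, x₀) := by rw [he, h0]
  have hc : AnalyticAt ℂ (fun x : ℂ => ((0 : ℂ), x)) x₀ := analyticAt_const.prod analyticAt_id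
  rw [hep] at hes
  refine ⟨fun x => (e.symm (0, x)).2, ?_, ?_, ?_⟩
  · exact analyticAt_snd.comp (AnalyticAt.comp (f := fun x : ℂ => ((0 : ℂ), x)) hes hc)
  · have := e.left_inv hp
    rw [hep] at this
    simp [this]
  · have ht : e.target ∈ 𝓝 ((0 : ℂ), x₀) := hep ▸ e.open_target.mem_nhds (e.map_source hp)
    filter_upwards [hc.continuousAt.preimage_mem_nhds ht] with x hx
    have h := e.right_inv hx
    rw [he, Prod.mk.injEq] at h
    have h2 : e.symm (0, x) = (x, (e.symm (0, x)).2) := Prod.ext h.2 rfl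
    rw [← h2]
    exact h.1

end

section

open Filter Topology Metric

/-! ### Linear differential equations with holomorphic coefficients -/

section Existence

variable {E : Type*} [NormedAddCommGroup E] [NormedSpace ℂ E] [CompleteSpace E]

/-- A primitive with value `0` at the centre of a ball. -/
theorem exists_primitive {f : ℂ → E} {c : ℂ} {r : ℝ} (hf : DifferentiableOn ℂ f (ball c r)) :
    ∃ g : ℂ → E, g c = 0 ∧ ∀ z ∈ ball c r, HasDerivAt g (f z) z :=
  hf.isExactOn_ball.with_val_at c 0

/-- Solutions of linear differential equations on small discs. -/
theorem exists_linear_solution {A : ℂ → E →L[ℂ] E} {c : ℂ} (hA : AnalyticAt ℂ A c) (w₀ : E) :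
    ∃ w : ℂ → E, w c = w₀ ∧ AnalyticAt ℂ w c ∧ ∀ᶠ t in 𝓝 c, HasDerivAt w (A t (w t)) t := by
  obtain ⟨K, hK0, hK⟩ : ∃ K : ℝ, 0 < K ∧ ∀ᶠ t in 𝓝 c, ‖A t‖ ≤ K := by
    refine ⟨‖A c‖ + 1, by positivity, ?_⟩
    filter_upwards [hA.continuousAt.norm.eventually_lt_const (lt_add_one ‖A c‖)] with t ht
    exact ht.le
  obtain ⟨ρ, hρ0, hρ⟩ := Metric.eventually_nhds_iff_ball.1 (hK.and hA.eventually_analyticAt)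
  -- With `K * r ≤ 1 / 2`, each Picard integration at least halves the bound on the norm.
  obtain ⟨r, hr0, hrρ, hrK⟩ : ∃ r : ℝ, 0 < r ∧ r ≤ ρ ∧ K * r ≤ 1 / 2 := by
    refine ⟨min ρ (1 / (2 * K)), by positivity, min_le_left _ _, ?_⟩
    calc K * min ρ (1 / (2 * K)) ≤ K * (1 / (2 * K)) := by gcongr; exact min_le_right _ _
      _ = 1 / 2 := by field_simp
  have hAK : ∀ t ∈ ball c r, ‖A t‖ ≤ K := fun t ht => (hρ t (ball_subset_ball hrρ ht)).1
  have hAd : DifferentiableOn ℂ A (ball c r) := fun t ht =>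
    (hρ t (ball_subset_ball hrρ ht)).2.differentiableAt.differentiableWithinAt
  -- the terms of the Picard series
  have step : ∀ g : ℂ → E, ∃ G : ℂ → E, DifferentiableOn ℂ g (ball c r) →
      G c = 0 ∧ ∀ z ∈ ball c r, HasDerivAt G (A z (g z)) z := by
    intro g
    by_cases hg : DifferentiableOn ℂ g (ball c r)
    · obtain ⟨G, hG⟩ := exists_primitive (hAd.clm_apply hg)
      exact ⟨G, fun _ => hG⟩
    · exact ⟨g, fun h => absurd h hg⟩
  choose P hP using step
  let W : ℕ → ℂ → E := fun k => P^[k] fun _ => w₀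
  have hWs : ∀ k, W (k + 1) = P (W k) := fun k => Function.iterate_succ_apply' _ _ _
  have hWd : ∀ k, DifferentiableOn ℂ (W k) (ball c r) := by
    intro k
    induction k with
    | zero => exact differentiableOn_const _
    | succ k ih =>
      rw [hWs]
      exact fun z hz => ((hP _ ih).2 z hz).differentiableAt.differentiableWithinAt
  have hWc : ∀ k, W (k + 1) c = 0 := fun k => by rw [hWs]; exact (hP _ (hWd k)).1
  have hW' : ∀ k, ∀ z ∈ ball c r, HasDerivAt (W (k + 1)) (A z (W k z)) z := fun k => by
    rw [hWs]; exact (hP _ (hWd k)).2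
  have hcr : c ∈ ball c r := mem_ball_self hr0
  have hWn : ∀ k, ∀ z ∈ ball c r, ‖W k z‖ ≤ (1 / 2) ^ k * ‖w₀‖ := by
    intro k
    induction k with
    | zero => intro z _; simp [W]
    | succ k ih =>
      intro z hz
      have h := (convex_ball c r).norm_image_sub_le_of_norm_hasDerivWithin_le
        (C := K * ((1 / 2) ^ k * ‖w₀‖))
        (fun x hx => (hW' k x hx).hasDerivWithinAt)
        (fun x hx => (ContinuousLinearMap.le_opNorm _ _).trans
          (mul_le_mul (hAK x hx) (ih x hx) (norm_nonneg _) hK0.le)) hcr hz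
      rw [hWc, sub_zero] at h
      have hzr : ‖z - c‖ ≤ r := (mem_ball_iff_norm.1 hz).le
      calc ‖W (k + 1) z‖ ≤ K * ((1 / 2) ^ k * ‖w₀‖) * ‖z - c‖ := h
        _ ≤ K * ((1 / 2) ^ k * ‖w₀‖) * r := by gcongr
        _ = (K * r) * ((1 / 2) ^ k * ‖w₀‖) := by ring
        _ ≤ 1 / 2 * ((1 / 2) ^ k * ‖w₀‖) := by gcongr
        _ = (1 / 2) ^ (k + 1) * ‖w₀‖ := by ring
  have hu : Summable fun k : ℕ => (1 / 2 : ℝ) ^ k * ‖w₀‖ := summable_geometric_two.mul_right _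
  have hS : ∀ z ∈ ball c r, Summable fun k => W k z := fun z hz =>
    Summable.of_norm_bounded hu fun k => hWn k z hz
  have hd : DifferentiableOn ℂ (fun z => ∑' k, W k z) (ball c r) :=
    Complex.differentiableOn_tsum_of_summable_norm hu hWd isOpen_ball fun k z hz => hWn k z hz
  refine ⟨fun z => ∑' k, W k z, ?_, hd.analyticAt (isOpen_ball.mem_nhds hcr), ?_⟩
  · show ∑' k, W k c = w₀
    rw [tsum_eq_single 0]
    · rfl
    · intro k hk
      obtain ⟨j, rfl⟩ := Nat.exists_eq_succ_of_ne_zero hk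
      exact hWc j
  · filter_upwards [isOpen_ball.mem_nhds hcr] with z hz
    have h1 := (hd.differentiableAt (isOpen_ball.mem_nhds hz)).hasDerivAt
    have h2 := Complex.hasSum_deriv_of_summable_norm hu hWd isOpen_ball
      (fun k z hz => hWn k z hz) hz
    -- Termwise differentiation shifts the index: `W (k + 1)` has derivative `A (W k)`, and the
    -- constant term `W 0` contributes nothing.
    have h3 : HasSum (fun k => deriv (W (k + 1)) z) (A z (∑' k, W k z)) := by
      simp only [fun k => (hW' k z hz).deriv]
      exact (hS z hz).hasSum.mapL (A z)
    have h4 : deriv (W 0) z = 0 := deriv_const _ _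
    have h5 := (hasSum_nat_add_iff' 1).2 h2
    rw [Finset.sum_range_one, h4, sub_zero] at h5
    rw [h3.unique h5]
    exact h1

end Existence

/-- The companion operator of the equation `u^{(l+1)} + ∑ a_k u^{(k)} = 0`. -/
noncomputable def companion (l : ℕ) (a : Fin (l + 1) → ℂ) :
    (Fin (l + 1) → ℂ) →L[ℂ] (Fin (l + 1) → ℂ) :=
  ContinuousLinearMap.pi (fun i : Fin (l + 1) =>
      if h : (i : ℕ) + 1 < l + 1 then ContinuousLinearMap.proj ⟨i + 1, h⟩ else 0) -
    ∑ k, a k • (ContinuousLinearMap.single ℂ (fun _ => ℂ) (Fin.last l)).comp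
      (ContinuousLinearMap.proj k)

theorem companion_apply_of_lt {l : ℕ} (a : Fin (l + 1) → ℂ) (v : Fin (l + 1) → ℂ) {i : ℕ}
    (hi : i + 1 < l + 1) : companion l a v ⟨i, by omega⟩ = v ⟨i + 1, hi⟩ := by
  have : (⟨i, by omega⟩ : Fin (l + 1)) ≠ Fin.last l := by
    intro h
    have := congrArg Fin.val h
    simp at this
    omega
  have hi' : i < l := by omega
  simp [companion, this, hi']

theorem companion_apply_last {l : ℕ} (a : Fin (l + 1) → ℂ) (v : Fin (l + 1) → ℂ) :
    companion l a v (Fin.last l) = -∑ k, a k * v k := by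
  simp [companion]

/-- The initial value problem for linear equations of order `n` with holomorphic coefficients. -/
theorem exists_linearOde_solution {n : ℕ} (hn : n ≠ 0) {a : Fin n → ℂ → ℂ} {c : ℂ}
    (ha : ∀ k, AnalyticAt ℂ (a k) c) (ζ : Fin n → ℂ) :
    ∃ u : ℂ → ℂ, AnalyticAt ℂ u c ∧ (∀ k : Fin n, iteratedDeriv k u c = ζ k) ∧
      ∀ᶠ t in 𝓝 c, LinearOdeAt n n a u t := by
  obtain ⟨l, rfl⟩ := Nat.exists_eq_succ_of_ne_zero hn
  have hA : AnalyticAt ℂ (fun t => companion l fun k => a k t) c := by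
    unfold companion
    refine analyticAt_const.sub ?_
    refine Finset.analyticAt_fun_sum _ fun k _ => ?_
    exact (ha k).smul analyticAt_const
  obtain ⟨w, hw0, hwa, hw⟩ := exists_linear_solution hA ζ
  have hwi : ∀ i, ∀ᶠ t in 𝓝 c,
      HasDerivAt (fun t => w t i) (companion l (fun k => a k t) (w t) i) t := fun i =>
    hw.mono fun t ht => hasDerivAt_pi.1 ht i
  -- The first rows of the companion system identify component `k` with the `k`-th derivative of
  -- component `0`.
  have hu : ∀ k (hk : k < l + 1), iteratedDeriv k (fun t => w t 0) =ᶠ[𝓝 c] fun t => w t ⟨k, hk⟩ := by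
    intro k
    induction k with
    | zero => intro _; rw [iteratedDeriv_zero]; rfl
    | succ k ih =>
      intro hk
      filter_upwards [(ih (by omega)).eventually_nhds, hwi ⟨k, by omega⟩] with t ht ht'
      rw [iteratedDeriv_succ, EventuallyEq.deriv_eq ht, ht'.deriv, companion_apply_of_lt _ _ hk]
  refine ⟨fun t => w t 0, ?_, ?_, ?_⟩
  · exact ((ContinuousLinearMap.proj (R := ℂ) (φ := fun _ : Fin (l + 1) => ℂ) 0).analyticAt _).comp
      hwa
  · intro k
    rw [(hu k k.2).eq_of_nhds, hw0]
  · filter_upwards [(hu l (Nat.lt_succ_self l)).eventually_nhds, hwi (Fin.last l),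
      eventually_all.2 fun k : Fin (l + 1) => hu k k.2] with t ht ht' hk
    have hlast : deriv (fun t => w t ⟨l, Nat.lt_succ_self l⟩) t = -∑ k, a k t * w t k := by
      rw [← companion_apply_last (fun k => a k t) (w t)]
      exact ht'.deriv
    rw [LinearOdeAt, iteratedDeriv_succ, EventuallyEq.deriv_eq ht, hlast]
    simp only [hk, Fin.eta]
    ring

end

section

open Filter Topology MvPolynomial JetPoly

variable {n m : ℕ}

/-! ### The total derivative along a graph -/

/-- The derivatives `y'(x), y''(x), …`. -/
noncomputable def graphJet (y : ℂ → ℂ) (x : ℂ) : ℕ → ℂ := fun k => iteratedDeriv (k + 1) y x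

/-- The value of a polynomial along the graph of `y`. -/
noncomputable abbrev evalGraph (w : DepVar n m → ℂ × ℂ → ℂ) (y : ℂ → ℂ) (x : ℂ) :
    JetPoly n m →+* ℂ :=
  evalJet (graphJet y x) (Indet.value w (x, y x))

/-- Both derivatives obey the Leibniz rule along `g`, so agreement on the variables suffices. -/
theorem hasDerivAt_eval_mkDerivation {σ : Type*} (f : σ → MvPolynomial σ ℂ) {g : ℂ → σ → ℂ} {x : ℂ}
    (hg : ∀ i, HasDerivAt (fun s => g s i) (eval (g x) (f i)) x) (P : MvPolynomial σ ℂ) :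
    HasDerivAt (fun s => eval (g s) P) (eval (g x) (mkDerivation ℂ f P)) x := by
  induction P using MvPolynomial.induction_on with
  | C a => simpa using hasDerivAt_const x a
  | add p q hp hq =>
    simp only [map_add]
    exact hp.add hq
  | mul_X p i hp =>
    have h := hp.mul (hg i)
    simp only [map_mul, eval_X, Derivation.leibniz, mkDerivation_X, smul_eq_mul, map_add]
    refine h.congr_deriv ?_
    ring

theorem analyticAt_iteratedDeriv {u : ℂ → ℂ} {t : ℂ} (hu : AnalyticAt ℂ u t) (k : ℕ) :
    AnalyticAt ℂ (iteratedDeriv k u) t := by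
  rw [iteratedDeriv_eq_iterate]
  exact hu.iterated_deriv k

theorem hasDerivAt_iteratedDeriv {u : ℂ → ℂ} {t : ℂ} (hu : AnalyticAt ℂ u t) (k : ℕ) :
    HasDerivAt (iteratedDeriv k u) (iteratedDeriv (k + 1) u t) t := by
  rw [iteratedDeriv_succ]
  exact (analyticAt_iteratedDeriv hu k).differentiableAt.hasDerivAt

/-- This identifies the formal `D_x` with differentiation along the graph. For the variables `jet v
i j` it is the chain rule together with the symmetry of mixed partial derivatives. -/
theorem hasDerivAt_evalGraph {w : DepVar n m → ℂ × ℂ → ℂ} {y : ℂ → ℂ} {x : ℂ}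
    (hw : ∀ v, AnalyticAt ℂ (w v) (x, y x)) (hy : AnalyticAt ℂ y x) (P : JetPoly n m) :
    HasDerivAt (fun s => evalGraph w y s P) (evalGraph w y x (totalDeriv P)) x := by
  refine hasDerivAt_eval_mkDerivation _ (g := fun s => Sum.elim (graphJet y s)
    (Indet.value w (s, y s))) (fun i => ?_) P
  rcases i with k | i | i | ⟨v, i, j⟩
  · simpa [dy, graphJet] using hasDerivAt_iteratedDeriv hy (k + 1)
  · simpa [Indet.value] using hasDerivAt_id' x
  · simpa [dy, graphJet, Indet.value] using hy.differentiableAt.hasDerivAt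
  · have ha := analyticAt_iterate_pdx (analyticAt_iterate_pdy (hw v) j) i
    have h := hasDerivAt_comp_pair (X := fun s => s) (Y := y) ha.differentiableAt (hasDerivAt_id x)
      hy.differentiableAt.hasDerivAt
    -- The `y`-derivative produced by the chain rule stands outside `pdx^[i]`, whereas `jet v i (j +
    -- 1)` has it inside.
    have hc := (iterate_pdx_pdy_comm (analyticAt_iterate_pdy (hw v) j) i).eq_of_nhds
    rw [← hc, ← Function.iterate_succ_apply' pdx, ← Function.iterate_succ_apply' pdy] at h
    simpa [jet, dy, graphJet, Indet.value] using h

theorem evalGraph_delta (w : DepVar n m → ℂ × ℂ → ℂ) (y : ℂ → ℂ) (x : ℂ) :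
    evalGraph w y x delta =
      pdx (w .psi) (x, y x) + pdy (w .psi) (x, y x) * deriv y x := by
  simp [evalGraph, delta, evalJet_jet, evalJet_dy, Indet.value, graphJet]

theorem evalJet_jacobian (Z : ℕ → ℂ) (w : DepVar n m → ℂ × ℂ → ℂ) (p : ℂ × ℂ) :
    evalJet Z (Indet.value w p) jacobian =
      pdx (w .phi) p * pdy (w .psi) p - pdy (w .phi) p * pdx (w .psi) p := by
  simp [jacobian, evalJet_jet, Indet.value]

/-- The graph of `y` is mapped to the graph of `u`, near the point of the former over `x`. -/
structure GraphMapsAt (w : DepVar n m → ℂ × ℂ → ℂ) (y u : ℂ → ℂ) (x : ℂ) : Prop where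
  analytic : ∀ v, AnalyticAt ℂ (w v) (x, y x)
  analytic_y : AnalyticAt ℂ y x
  analytic_u : AnalyticAt ℂ u (w .psi (x, y x))
  map_eq : ∀ᶠ s in 𝓝 x, u (w .psi (s, y s)) = w .phi (s, y s)

namespace GraphMapsAt

variable {w : DepVar n m → ℂ × ℂ → ℂ} {y u : ℂ → ℂ} {x : ℂ}

theorem continuousAt_graph (h : GraphMapsAt w y u x) : ContinuousAt (fun s => (s, y s)) x :=
  continuousAt_id.prodMk h.analytic_y.continuousAt

theorem continuousAt_psi (h : GraphMapsAt w y u x) :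
    ContinuousAt (fun s => w .psi (s, y s)) x :=
  ContinuousAt.comp (f := fun s => (s, y s)) (h.analytic .psi).continuousAt h.continuousAt_graph

theorem eventually (h : GraphMapsAt w y u x)
    (hw : ∀ᶠ q in 𝓝 (x, y x), ∀ v, AnalyticAt ℂ (w v) q) :
    ∀ᶠ s in 𝓝 x, GraphMapsAt w y u s := by
  filter_upwards [h.analytic_y.eventually_analyticAt, h.map_eq.eventually_nhds,
    h.continuousAt_graph.eventually hw,
    h.continuousAt_psi.eventually h.analytic_u.eventually_analyticAt] with s h1 h2 h3 h4
  exact ⟨h3, h1, h4, h2⟩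

theorem hasDerivAt_comp_psi (h : GraphMapsAt w y u x) (k : ℕ) :
    HasDerivAt (fun s => iteratedDeriv k u (w .psi (s, y s)))
      (iteratedDeriv (k + 1) u (w .psi (x, y x)) * evalGraph w y x delta) x := by
  have h1 := hasDerivAt_comp_pair (X := fun s => s) (Y := y) (h.analytic .psi).differentiableAt
    (hasDerivAt_id x) h.analytic_y.differentiableAt.hasDerivAt
  rw [mul_one, ← evalGraph_delta] at h1
  exact HasDerivAt.comp (h := fun s => w .psi (s, y s)) x
    (hasDerivAt_iteratedDeriv h.analytic_u k) h1

/-- The derivatives of `u` in terms of those of `y`. -/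
theorem iteratedDeriv_mul (h : GraphMapsAt w y u x)
    (hw : ∀ᶠ q in 𝓝 (x, y x), ∀ v, AnalyticAt ℂ (w v) q) (k : ℕ) :
    ∀ᶠ s in 𝓝 x, iteratedDeriv (k + 1) u (w .psi (s, y s)) *
      evalGraph w y s delta ^ (2 * k + 1) = evalGraph w y s (derivNumerator k) := by
  induction k with
  | zero =>
    filter_upwards [h.map_eq.eventually_nhds, h.eventually hw] with s hs hg
    have h1 := hasDerivAt_comp_pair (X := fun s => s) (Y := y) (hg.analytic .phi).differentiableAt
      (hasDerivAt_id s) hg.analytic_y.differentiableAt.hasDerivAt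
    have h2 := (hg.hasDerivAt_comp_psi 0).unique (h1.congr_of_eventuallyEq (by simpa [EventuallyEq] using hs))
    rw [Nat.mul_zero, zero_add, pow_one, h2]
    simp [evalGraph, derivNumerator, evalJet_jet, evalJet_dy, Indet.value, graphJet]
  | succ k ih =>
    filter_upwards [ih.eventually_nhds, h.eventually hw] with s hs hg
    have h1 := (hg.hasDerivAt_comp_psi (k + 1)).mul
      ((hasDerivAt_evalGraph hg.analytic hg.analytic_y delta).pow (2 * k + 1))
    have h2 := hasDerivAt_evalGraph hg.analytic hg.analytic_y (derivNumerator k)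
    -- The identity for `k` is differentiated along the graph in two ways; multiplying by `δ` and
    -- reinserting the identity yields the recursion for the numerators.
    have h3 := (h2.congr_of_eventuallyEq hs).unique h1
    have h4 := hs.self_of_nhds
    simp only [derivNumerator, map_sub, map_mul, map_add, map_one, map_natCast, map_ofNat]
    rw [h3, ← h4]
    simp only [Pi.pow_apply, Nat.add_sub_cancel]
    push_cast
    ring

/-- As `u' δ = φ_x + φ_y y'`, vanishing of `δ` would make both `φ` and `ψ` stationary in the
direction `(1, y')`, contrary to `J ≠ 0`. -/
theorem delta_ne_zero (h : GraphMapsAt w y u x)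
    (hw : ∀ᶠ q in 𝓝 (x, y x), ∀ v, AnalyticAt ℂ (w v) q)
    (hJ : evalGraph w y x jacobian ≠ 0) : evalGraph w y x delta ≠ 0 := by
  intro hd
  have h1 := (h.iteratedDeriv_mul hw 0).self_of_nhds
  rw [hd, Nat.mul_zero, zero_add, pow_one, mul_zero] at h1
  apply hJ
  rw [evalGraph_delta] at hd
  rw [evalGraph, evalJet_jacobian]
  simp only [evalGraph, derivNumerator, map_add, map_mul, evalJet_jet, evalJet_dy, Indet.value,
    graphJet, Function.iterate_succ, Function.iterate_zero, Function.comp, id,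
    iteratedDeriv_one, zero_add] at h1
  linear_combination -pdy (w .psi) (x, y x) * h1 - pdy (w .phi) (x, y x) * hd

theorem evalGraph_scaledDeriv (h : GraphMapsAt w y u x)
    (hw : ∀ᶠ q in 𝓝 (x, y x), ∀ v, AnalyticAt ℂ (w v) q) {k : ℕ} (hk : k ≤ n) :
    evalGraph w y x (scaledDeriv k) =
      evalGraph w y x delta ^ (2 * n - 1) * iteratedDeriv k u (w .psi (x, y x)) := by
  rcases k with _ | k
  · have h0 := h.map_eq.self_of_nhds
    simp [scaledDeriv, evalGraph, evalJet_jet, Indet.value, h0]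
  · have h1 := (h.iteratedDeriv_mul hw k).self_of_nhds
    rw [scaledDeriv, map_mul, map_pow, ← h1,
      show 2 * n - 1 = 2 * (n - (k + 1)) + (2 * k + 1) by omega, pow_add]
    ring

/-- The transformation of the normal form. -/
theorem transformed_normalForm (h : GraphMapsAt w y u x)
    (hw : ∀ᶠ q in 𝓝 (x, y x), ∀ v, AnalyticAt ℂ (w v) q) {b : Fin (n - 2) → ℂ → ℂ}
    (hb : ∀ k, w (.a k) (x, y x) = b k (w .psi (x, y x))) :
    evalGraph w y x delta ^ (2 * n - 1) *
      (iteratedDeriv n u (w .psi (x, y x)) +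
        ∑ k : Fin (n - 2), b k (w .psi (x, y x)) * iteratedDeriv k u (w .psi (x, y x))) =
    -(evalGraph w y x jacobian * evalGraph w y x delta ^ (n - 2) * graphJet y x (n - 1) +
      evalGraph w y x remainder) := by
  have h1 : evalGraph w y x (transformedNormalForm : JetPoly n m) =
      evalGraph w y x delta ^ (2 * n - 1) *
      (iteratedDeriv n u (w .psi (x, y x)) +
        ∑ k : Fin (n - 2), b k (w .psi (x, y x)) * iteratedDeriv k u (w .psi (x, y x))) := by
    rw [transformedNormalForm, map_add, map_sum, h.evalGraph_scaledDeriv hw le_rfl, mul_add,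
      Finset.mul_sum]
    congr 1
    refine Finset.sum_congr rfl fun k _ => ?_
    rw [map_mul, h.evalGraph_scaledDeriv hw (by omega), evalJet_jet, ← hb]
    simp only [Indet.value, Function.iterate_zero, id]
    ring
  rw [← h1, remainder]
  simp only [map_neg, map_add, map_mul, map_pow, evalJet_dy]
  ring

end GraphMapsAt

/-- The linearizing equation at a jet relates the two differential equations. -/
theorem evalGraph_linearizationPoly (f : RatFun n m) (w : DepVar n m → ℂ × ℂ → ℂ) (y : ℂ → ℂ)
    (x : ℂ) :
    evalGraph w y x (linearizationPoly f) =
      evalGraph w y x remainder *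
          evalAt (fun i => w (.h i)) (x, y x) (derivs n y x) (denominator f) -
        evalGraph w y x jacobian *
          evalAt (fun i => w (.h i)) (x, y x) (derivs n y x) (numerator f) *
          evalGraph w y x delta ^ (n - 2) := by
  simp only [linearizationPoly, map_sub, map_mul, map_pow, evalJet_rename_ofEqVar]
  rfl

/-! ### Comparison of the two equations at one point -/

section Equivalence

variable {w : DepVar n m → ℂ × ℂ → ℂ} {y u : ℂ → ℂ} {x : ℂ} {f : RatFun n m}
  {b : Fin (n - 2) → ℂ → ℂ}

theorem graphJet_pred (hn : 2 ≤ n) : graphJet y x (n - 1) = iteratedDeriv n y x := by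
  rw [graphJet, Nat.sub_add_cancel (by omega)]

/-- The linearizing equation gives `R = J δ^{n-2} M / N`. The left-hand sides of the two equations
then differ by the factors `δ^{2n-1}` and `-J δ^{n-2}`, neither of which is zero. -/
theorem odeAt_iff_linearOdeAt (hn : 2 ≤ n) (h : GraphMapsAt w y u x)
    (hw : ∀ᶠ q in 𝓝 (x, y x), ∀ v, AnalyticAt ℂ (w v) q)
    (hb : ∀ k, w (.a k) (x, y x) = b k (w .psi (x, y x)))
    (hJ : evalGraph w y x jacobian ≠ 0) (hN : IsRegularAt f (fun i => w (.h i)) y x)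
    (hlin : evalGraph w y x (linearizationPoly f) = 0) :
    OdeAt f (fun i => w (.h i)) y x ↔ LinearOdeAt n (n - 2) b u (w .psi (x, y x)) := by
  have hd := h.delta_ne_zero hw hJ
  have ht := h.transformed_normalForm hw hb
  rw [evalGraph_linearizationPoly] at hlin
  rw [graphJet_pred hn] at ht
  unfold OdeAt LinearOdeAt
  unfold IsRegularAt at hN
  generalize evalAt (fun i => w (.h i)) (x, y x) (derivs n y x) (denominator f) = N at *
  generalize evalAt (fun i => w (.h i)) (x, y x) (derivs n y x) (numerator f) = M at *
  generalize evalGraph w y x (remainder : JetPoly n m) = R at *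
  have hR : R = evalGraph w y x jacobian * evalGraph w y x delta ^ (n - 2) * (M / N) := by
    field_simp
    linear_combination hlin
  have key : evalGraph w y x delta ^ (2 * n - 1) *
      (iteratedDeriv n u (w .psi (x, y x)) +
        ∑ k : Fin (n - 2), b k (w .psi (x, y x)) * iteratedDeriv k u (w .psi (x, y x))) =
      -(evalGraph w y x jacobian * evalGraph w y x delta ^ (n - 2)) *
        (iteratedDeriv n y x + M / N) := by
    rw [ht, hR]
    ring
  have h1 : evalGraph w y x delta ^ (2 * n - 1) ≠ 0 := pow_ne_zero _ hd
  have h2 : -(evalGraph w y x jacobian * evalGraph w y x delta ^ (n - 2)) ≠ 0 :=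
    neg_ne_zero.2 (mul_ne_zero hJ (pow_ne_zero _ hd))
  rw [← mul_eq_zero_iff_left h2, ← key, mul_eq_zero_iff_left h1]

/-- If both equations hold at the point, `y^{(n)} = -M / N` can be inserted into `J δ^{n-2} y^{(n)}
+ R = 0`. -/
theorem linearizationPoly_eq_zero (hn : 2 ≤ n) (h : GraphMapsAt w y u x)
    (hw : ∀ᶠ q in 𝓝 (x, y x), ∀ v, AnalyticAt ℂ (w v) q)
    (hb : ∀ k, w (.a k) (x, y x) = b k (w .psi (x, y x)))
    (hN : IsRegularAt f (fun i => w (.h i)) y x) (hy : OdeAt f (fun i => w (.h i)) y x)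
    (hu : LinearOdeAt n (n - 2) b u (w .psi (x, y x))) :
    evalGraph w y x (linearizationPoly f) = 0 := by
  have ht := h.transformed_normalForm hw hb
  rw [evalGraph_linearizationPoly]
  rw [graphJet_pred hn] at ht
  unfold OdeAt at hy
  unfold LinearOdeAt at hu
  unfold IsRegularAt at hN
  rw [hu, mul_zero, eq_neg_of_add_eq_zero_left hy] at ht
  generalize evalAt (fun i => w (.h i)) (x, y x) (derivs n y x) (denominator f) = N at *
  generalize evalAt (fun i => w (.h i)) (x, y x) (derivs n y x) (numerator f) = M at *
  field_simp at ht
  linear_combination ht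

end Equivalence

end

section

open Filter Topology MvPolynomial JetPoly Metric

variable {n m : ℕ}

/-! ### Solutions of the linearizing system yield linearizations -/

theorem hasDerivAt_pdx {F : ℂ × ℂ → ℂ} {p : ℂ × ℂ} (hF : AnalyticAt ℂ F p) :
    HasDerivAt (fun s => F (s, p.2)) (pdx F p) p.1 := by
  have h := hasDerivAt_comp_pair (F := F) (X := fun s => s) (Y := fun _ => p.2)
    hF.differentiableAt (hasDerivAt_id' p.1) (hasDerivAt_const _ _)
  simpa using h

theorem hasDerivAt_pdy {F : ℂ × ℂ → ℂ} {p : ℂ × ℂ} (hF : AnalyticAt ℂ F p) :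
    HasDerivAt (fun s => F (p.1, s)) (pdy F p) p.2 := by
  have h := hasDerivAt_comp_pair (F := F) (X := fun _ => p.1) (Y := fun s => s)
    hF.differentiableAt (hasDerivAt_const _ _) (hasDerivAt_id' p.2)
  simpa using h

/-- Near each point, functions with vanishing Jacobians with `ψ` are functions of `ψ`. -/
theorem exists_eq_comp {ι : Type*} {φ ψ : ℂ × ℂ → ℂ} {a : ι → ℂ × ℂ → ℂ} {U : Set (ℂ × ℂ)}
    (hU : IsOpen U) (hφ : AnalyticOnNhd ℂ φ U) (hψ : AnalyticOnNhd ℂ ψ U)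
    (ha : ∀ k, AnalyticOnNhd ℂ (a k) U)
    (hJ : ∀ p ∈ U, pdx φ p * pdy ψ p - pdy φ p * pdx ψ p ≠ 0)
    (haψ : ∀ k, ∀ p ∈ U, pdy ψ p * pdx (a k) p - pdx ψ p * pdy (a k) p = 0)
    {p₀ : ℂ × ℂ} (hp₀ : p₀ ∈ U) :
    ∃ U' ⊆ U, IsPointTransformation φ ψ U' ∧ ∃ b : ι → ℂ → ℂ,
      (∀ k, AnalyticOnNhd ℂ (b k) (ψ '' U')) ∧ ∀ k, ∀ p ∈ U', a k p = b k (ψ p) := by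
  obtain ⟨e, hp, he, hes⟩ := exists_local_inverse (hφ p₀ hp₀) (hψ p₀ hp₀) (hJ p₀ hp₀)
  have hB : ∀ᶠ q in 𝓝 (e p₀), q ∈ e.target ∧ AnalyticAt ℂ e.symm q ∧ e.symm q ∈ U := by
    refine (e.open_target.eventually_mem (e.map_source hp)).and
      (hes.eventually_analyticAt.and ?_)
    refine hes.continuousAt.eventually ?_
    rw [e.left_inv hp]
    exact hU.mem_nhds hp₀
  obtain ⟨r, hr0, hr⟩ := Metric.eventually_nhds_iff_ball.1 hB
  set u₀ := (e p₀).1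
  set t₀ := (e p₀).2
  -- For the sup norm a ball is a product of discs, so the slices with fixed second coordinate are
  -- connected.
  have hball : ∀ q : ℂ × ℂ, q ∈ ball (e p₀) r ↔ q.1 ∈ ball u₀ r ∧ q.2 ∈ ball t₀ r := by
    intro q
    rw [show e p₀ = (u₀, t₀) from rfl, ← ball_prod_same]
    rfl
  have hU'U : e.source ∩ e ⁻¹' ball (e p₀) r ⊆ U := by
    rintro p ⟨h1, h2⟩
    have := (hr _ h2).2.2
    rwa [e.left_inv h1] at this
  -- In the coordinates `(φ, ψ)`, the Jacobian of `a k` and `ψ` is the derivative of `a k` in the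
  -- first coordinate times the nonzero `J`.
  have hzero : ∀ k, ∀ q ∈ ball (e p₀) r, pdx (a k ∘ e.symm) q = 0 := by
    intro k q hq
    obtain ⟨hqt, hqa, hqU⟩ := hr q hq
    set p := e.symm q with hpq
    have hep : (φ p, ψ p) = q := by rw [← he, hpq, e.right_inv hqt]
    have hα : AnalyticAt ℂ (a k ∘ e.symm) (φ p, ψ p) := by
      rw [hep]
      exact (ha k _ hqU).comp hqa
    have hev : ∀ᶠ p' in 𝓝 p, a k p' = (a k ∘ e.symm) (φ p', ψ p') := by
      filter_upwards [e.open_source.mem_nhds (e.map_target hqt)] with p' hp'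
      rw [Function.comp, ← he, e.left_inv hp']
    have hx : pdx (a k) p = pdx (a k ∘ e.symm) q * pdx φ p + pdy (a k ∘ e.symm) q * pdx ψ p := by
      have h := hasDerivAt_comp_pair (X := fun s => φ (s, p.2)) (Y := fun s => ψ (s, p.2))
        hα.differentiableAt (hasDerivAt_pdx (hφ p hqU)) (hasDerivAt_pdx (hψ p hqU))
      rw [(pdx_congr hev).eq_of_nhds, ← hep]
      exact h.deriv
    have hy : pdy (a k) p = pdx (a k ∘ e.symm) q * pdy φ p + pdy (a k ∘ e.symm) q * pdy ψ p := by
      have h := hasDerivAt_comp_pair (X := fun s => φ (p.1, s)) (Y := fun s => ψ (p.1, s))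
        hα.differentiableAt (hasDerivAt_pdy (hφ p hqU)) (hasDerivAt_pdy (hψ p hqU))
      rw [(pdy_congr hev).eq_of_nhds, ← hep]
      exact h.deriv
    have h0 := haψ k p hqU
    rw [hx, hy] at h0
    refine (mul_eq_zero.1 (?_ : pdx (a k ∘ e.symm) q *
      (pdx φ p * pdy ψ p - pdy φ p * pdx ψ p) = 0)).resolve_right (hJ p hqU)
    linear_combination h0
  refine ⟨e.source ∩ e ⁻¹' ball (e p₀) r, hU'U, ⟨e.isOpen_inter_preimage isOpen_ball,
    ⟨p₀, hp, mem_ball_self hr0⟩, hφ.mono hU'U, hψ.mono hU'U, ?_, fun p h => hJ p (hU'U h)⟩,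
    fun k t => a k (e.symm (u₀, t)), ?_, ?_⟩
  · refine (e.injOn.mono Set.inter_subset_left).congr fun p _ => ?_
    exact he p
  · rintro k _ ⟨p, ⟨hps, hpb⟩, rfl⟩
    have hψp : ψ p ∈ ball t₀ r := by
      have := ((hball _).1 hpb).2
      rwa [he] at this
    obtain ⟨-, h2, h3⟩ := hr (u₀, ψ p) ((hball _).2 ⟨mem_ball_self hr0, hψp⟩)
    exact AnalyticAt.comp (g := a k) (f := fun t => e.symm (u₀, t)) (ha k _ h3)
      (AnalyticAt.comp (f := fun t => (u₀, t)) h2 (analyticAt_const.prod analyticAt_id))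
  · rintro k p ⟨hps, hpb⟩
    have hb := (hball _).1 hpb
    rw [he] at hb
    have hd : ∀ s ∈ ball u₀ r, HasDerivAt (fun s => a k (e.symm (s, ψ p))) 0 s := by
      intro s hs
      have hq := (hball (s, ψ p)).2 ⟨hs, hb.2⟩
      rw [← hzero k _ hq]
      exact hasDerivAt_pdx (F := a k ∘ e.symm) (p := (s, ψ p))
        ((ha k _ (hr _ hq).2.2).comp (hr _ hq).2.1)
    have := isOpen_ball.is_const_of_deriv_eq_zero (convex_ball u₀ r).isPreconnected
      (fun s hs => (hd s hs).differentiableAt.differentiableWithinAt)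
      (fun s hs => (hd s hs).deriv) hb.1 (mem_ball_self hr0)
    change a k p = a k (e.symm (u₀, ψ p))
    rw [← this]
    change a k p = a k (e.symm (φ p, ψ p))
    rw [← he, e.left_inv hps]

/-- After shrinking `U` the coefficients become functions of `ψ`, and the equivalence required of
the transformation holds separately at every `x`. -/
theorem isLinearizableToNormalForm_of_isConsistent (hn : 2 ≤ n) {f : RatFun n m}
    {h : Fin m → ℂ × ℂ → ℂ} {D : Set (ℂ × ℂ)} (hS : (linearizingSystem f).IsConsistent h D) :
    IsLinearizableToNormalForm f h D := by
  obtain ⟨U, φ, ψ, a, hUD, hU, ⟨p₀, hp₀⟩, hS⟩ := hS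
  have hJ : ∀ p ∈ U, pdx φ p * pdy ψ p - pdy φ p * pdx ψ p ≠ 0 := by
    intro p hp
    simpa [DiffPoly.jet, Indet.value, assign] using hS.ineqs _ rfl p hp
  have haψ : ∀ k, ∀ p ∈ U, pdy ψ p * pdx (a k) p - pdx ψ p * pdy (a k) p = 0 := by
    intro k p hp
    simpa [DiffPoly.jet, Indet.value, assign] using hS.eqs _ (Or.inr ⟨k, rfl⟩) p hp
  have hlin : ∀ p ∈ U, ∀ Z, evalJet Z (Indet.value (assign φ ψ a h) p) (linearizationPoly f) = 0 :=
    fun p hp => (coeffs_vanish_iff _ _).1 fun c hc => hS.eqs c (Or.inl hc) p hp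
  obtain ⟨U', hU'U, hU', b, hb, hab⟩ := exists_eq_comp hU (hS.analytic .phi) (hS.analytic .psi)
    (fun k => hS.analytic (.a k)) hJ haψ hp₀
  refine ⟨U', φ, ψ, b, hU'U.trans hUD, hU', hb, ?_⟩
  intro V y u hV hy hyU hreg hu huφ
  refine forall₂_congr fun x hx => ?_
  have hxU := hU'U (hyU x hx)
  exact odeAt_iff_linearOdeAt (w := assign φ ψ a h) hn
    ⟨fun v => hS.analytic v _ hxU, hy x hx, hu _ ⟨x, hx, rfl⟩,
      Filter.eventually_of_mem (hV.mem_nhds hx) huφ⟩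
    (Filter.eventually_of_mem (hU.mem_nhds hxU) fun q hq v => hS.analytic v q hq)
    (fun k => hab k _ (hyU x hx))
    (by rw [evalJet_jacobian]; exact hJ _ hxU) (hreg x hx) (hlin _ hxU _)

/-! ### Padding with zero coefficients -/

/-- Further coefficients that are zero. -/
def padCoeff {r s : ℕ} (a : Fin r → ℂ → ℂ) (k : Fin s) : ℂ → ℂ :=
  if hk : (k : ℕ) < r then a ⟨k, hk⟩ else 0

theorem linearOdeAt_padCoeff {r s : ℕ} (hrs : r ≤ s) (a : Fin r → ℂ → ℂ) (u : ℂ → ℂ) (t : ℂ) :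
    LinearOdeAt n s (padCoeff a) u t ↔ LinearOdeAt n r a u t := by
  obtain ⟨q, rfl⟩ := Nat.exists_eq_add_of_le hrs
  simp [LinearOdeAt, Fin.sum_univ_add, padCoeff]

theorem analyticAt_padCoeff {r s : ℕ} {a : Fin r → ℂ → ℂ} {t : ℂ}
    (ha : ∀ k, AnalyticAt ℂ (a k) t) (k : Fin s) : AnalyticAt ℂ (padCoeff a k) t := by
  unfold padCoeff
  split_ifs with hk
  · exact ha _
  · exact analyticAt_const

theorem IsLinearizableTo.mono {r s : ℕ} (hrs : r ≤ s) {f : RatFun n m} {h : Fin m → ℂ × ℂ → ℂ}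
    {D : Set (ℂ × ℂ)} (hf : IsLinearizableTo r f h D) : IsLinearizableTo s f h D := by
  obtain ⟨U, φ, ψ, a, hUD, hU, ha, hmap⟩ := hf
  refine ⟨U, φ, ψ, padCoeff a, hUD, hU,
    fun k t ht => analyticAt_padCoeff (fun k => ha k t ht) k, ?_⟩
  intro V y u hV hy hyU hreg hu huφ
  simp only [linearOdeAt_padCoeff hrs]
  exact hmap V y u hV hy hyU hreg hu huφ

end

section

open Filter Topology MvPolynomial JetPoly

variable {n m : ℕ}

/-! ### Linearizations to normal form yield solutions of the linearizing system -/

theorem analyticAt_eval {σ E : Type*} [NormedAddCommGroup E] [NormedSpace ℂ E] {g : E → σ → ℂ}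
    {x : E} (hg : ∀ i, AnalyticAt ℂ (fun s => g s i) x) (P : MvPolynomial σ ℂ) :
    AnalyticAt ℂ (fun s => eval (g s) P) x := by
  induction P using MvPolynomial.induction_on with
  | C a => simpa using analyticAt_const
  | add p q hp hq =>
    simp only [map_add]
    exact hp.add hq
  | mul_X p i hp =>
    simp only [map_mul, eval_X]
    exact hp.mul (hg i)

theorem analyticAt_evalAt {h : Fin m → ℂ × ℂ → ℂ} {p : ℂ × ℂ} (hh : ∀ i, AnalyticAt ℂ (h i) p)
    (z : Fin (n - 1) → ℂ) (g : MvPolynomial (EqVar n m) ℂ) :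
    AnalyticAt ℂ (fun p => evalAt h p z g) p := by
  refine analyticAt_eval (fun i => ?_) g
  cases i with
  | x => exact analyticAt_fst
  | y => exact analyticAt_snd
  | h i => exact hh i
  | dy k => exact analyticAt_const

section Jets

variable {w : DepVar n m → ℂ × ℂ → ℂ} {y u : ℂ → ℂ} {x : ℂ} {Z : ℕ → ℂ}

/-- The derivatives of `y` are determined by those of `u`. -/
theorem GraphMapsAt.graphJet_eq (h : GraphMapsAt w y u x)
    (hw : ∀ᶠ q in 𝓝 (x, y x), ∀ v, AnalyticAt ℂ (w v) q)
    (hJ : evalJet Z (Indet.value w (x, y x)) jacobian ≠ 0)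
    (hδ : evalJet Z (Indet.value w (x, y x)) delta ≠ 0) {l : ℕ}
    (hu : ∀ k < l, iteratedDeriv (k + 1) u (w .psi (x, y x)) *
      evalJet Z (Indet.value w (x, y x)) delta ^ (2 * k + 1) =
        evalJet Z (Indet.value w (x, y x)) (derivNumerator k)) :
    ∀ k < l, graphJet y x k = Z k := by
  intro k
  induction k using Nat.strong_induction_on with
  | _ k ih =>
    intro hk
    have h1 := (h.iteratedDeriv_mul hw k).self_of_nhds
    have h2 := hu k hk
    rcases k with _ | k
    · rw [evalJet_jacobian] at hJ
      simp only [evalGraph, delta, derivNumerator, map_add, map_mul, evalJet_jet, evalJet_dy,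
        Indet.value, Function.iterate_succ, Function.iterate_zero, Function.comp, id, Nat.mul_zero,
        zero_add, pow_one] at h1 h2 hδ
      generalize iteratedDeriv 1 u (w .psi (x, y x)) = u₁ at h1 h2
      -- Eliminating `u'` from the two relations leaves `J` times the difference of the slopes.
      have h3 : (pdx (w .phi) (x, y x) * pdy (w .psi) (x, y x) -
          pdy (w .phi) (x, y x) * pdx (w .psi) (x, y x)) * (graphJet y x 0 - Z 0) = 0 := by
        linear_combination
          (pdx (w .psi) (x, y x) + pdy (w .psi) (x, y x) * Z 0) * h1 -
            (pdx (w .psi) (x, y x) + pdy (w .psi) (x, y x) * graphJet y x 0) * h2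
      exact sub_eq_zero.1 ((mul_eq_zero.1 h3).resolve_left hJ)
    · have hlow : ∀ j < k + 1, graphJet y x j = Z j := fun j hj => ih j hj (by omega)
      have hd : evalGraph w y x (delta : JetPoly n m) =
          evalJet Z (Indet.value w (x, y x)) delta :=
        evalJet_congr (delta_mem (Nat.succ_pos k)) _ hlow
      have hJ' : evalGraph w y x (jacobian : JetPoly n m) =
          evalJet Z (Indet.value w (x, y x)) jacobian :=
        evalJet_congr (jacobian_mem 0) _ (by simp)
      have hQ := evalJet_congr (derivNumerator_succ_add_mem (n := n) (m := m) k)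
        (Indet.value w (x, y x)) hlow
      simp only [map_add, map_mul, map_pow, evalJet_dy] at hQ
      rw [hd, h2] at h1
      rw [hd, hJ', ← h1] at hQ
      -- All lower derivatives agree, so only the top-order term can differ; its coefficient `J δ^k`
      -- is nonzero.
      have h3 : evalJet Z (Indet.value w (x, y x)) jacobian *
          evalJet Z (Indet.value w (x, y x)) delta ^ k * (graphJet y x (k + 1) - Z (k + 1)) = 0 := by
        linear_combination hQ
      exact sub_eq_zero.1 ((mul_eq_zero.1 h3).resolve_left (mul_ne_zero hJ (pow_ne_zero _ hδ)))

end Jets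

/-! ### Realisation of jets by solutions -/

section Converse

variable {f : RatFun n m} {h : Fin m → ℂ × ℂ → ℂ} {φ ψ : ℂ × ℂ → ℂ} {b : Fin (n - 2) → ℂ → ℂ}
  {U : Set (ℂ × ℂ)}

/-- The jet is realised by a curve whose image solves the linear equation. By `hmap` the curve
solves the original equation, and the two equations together give the claim at the base point. -/
theorem MapsEquation.linearizationPoly_eq_zero_of_ne_zero (hn : 2 ≤ n)
    (hmap : MapsEquation f h b φ ψ U) (hU : IsPointTransformation φ ψ U)
    (hh : ∀ i, AnalyticOnNhd ℂ (h i) U) (hb : ∀ k, AnalyticOnNhd ℂ (b k) (ψ '' U))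
    {p : ℂ × ℂ} (hp : p ∈ U) (Z : ℕ → ℂ)
    (hN : evalJet Z (Indet.value (assign φ ψ (fun k q => b k (ψ q)) h) p)
      (rename ofEqVar (denominator f)) ≠ 0)
    (hδ : evalJet Z (Indet.value (assign φ ψ (fun k q => b k (ψ q)) h) p) delta ≠ 0) :
    evalJet Z (Indet.value (assign φ ψ (fun k q => b k (ψ q)) h) p) (linearizationPoly f) = 0 := by
  obtain ⟨x₀, y₀⟩ := p
  set w : DepVar n m → ℂ × ℂ → ℂ := assign φ ψ (fun k q => b k (ψ q)) h with hw
  have hwU : ∀ q ∈ U, ∀ v, AnalyticAt ℂ (w v) q := by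
    intro q hq v
    cases v with
    | phi => exact hU.analytic_phi q hq
    | psi => exact hU.analytic_psi q hq
    | a k => exact (hb k (ψ q) ⟨q, hq, rfl⟩).comp (hU.analytic_psi q hq)
    | h i => exact hh i q hq
  have hUp : U ∈ 𝓝 (x₀, y₀) := hU.isOpen.mem_nhds hp
  have hJ : evalJet Z (Indet.value w (x₀, y₀)) jacobian ≠ 0 := by
    rw [evalJet_jacobian]
    exact hU.jacobian_ne_zero _ hp
  -- the solution of the linear equation with the given derivatives
  obtain ⟨u, hua, hu0, hu⟩ := exists_linearOde_solution (n := n) (by omega)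
    (a := padCoeff b) (c := ψ (x₀, y₀))
    (fun k => analyticAt_padCoeff (fun k => hb k _ ⟨_, hp, rfl⟩) k)
    -- The initial values are those forced by the jet: `u = φ` and `u^{(k)} = derivNumerator (k - 1)
    -- / δ^{2k-1}` for `k ≥ 1`.
    (fun k => if (k : ℕ) = 0 then φ (x₀, y₀) else
      evalJet Z (Indet.value w (x₀, y₀)) (derivNumerator ((k : ℕ) - 1)) /
        evalJet Z (Indet.value w (x₀, y₀)) delta ^ (2 * ((k : ℕ) - 1) + 1))
  have hu0' : u (ψ (x₀, y₀)) = φ (x₀, y₀) := by simpa using hu0 ⟨0, by omega⟩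
  have huk : ∀ k < n - 1, iteratedDeriv (k + 1) u (ψ (x₀, y₀)) *
      evalJet Z (Indet.value w (x₀, y₀)) delta ^ (2 * k + 1) =
        evalJet Z (Indet.value w (x₀, y₀)) (derivNumerator k) := by
    intro k hk
    have := hu0 ⟨k + 1, by omega⟩
    simp only [Nat.succ_ne_zero, if_false, Nat.add_sub_cancel] at this
    rw [this, div_mul_cancel₀ _ (pow_ne_zero _ hδ)]
  -- the function whose graph is mapped to the graph of this solution
  have hFa : AnalyticAt ℂ (fun q => φ q - u (ψ q)) (x₀, y₀) :=
    (hU.analytic_phi _ hp).sub (hua.comp (hU.analytic_psi _ hp))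
  have hFy : pdy (fun q => φ q - u (ψ q)) (x₀, y₀) =
      pdy φ (x₀, y₀) - iteratedDeriv 1 u (ψ (x₀, y₀)) * pdy ψ (x₀, y₀) := by
    have h1 := hasDerivAt_pdy (hU.analytic_phi _ hp)
    have h2 := hasDerivAt_pdy (hU.analytic_psi _ hp)
    rw [iteratedDeriv_one]
    exact (h1.sub (HasDerivAt.comp (h := fun s => ψ (x₀, s)) y₀
      hua.differentiableAt.hasDerivAt h2)).deriv
  -- If `φ_y = u' ψ_y`, then `u' δ = φ_x + φ_y y'` also gives `φ_x = u' ψ_x`, and `J` would vanish.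
  have hFy0 : pdy (fun q => φ q - u (ψ q)) (x₀, y₀) ≠ 0 := by
    intro h0
    rw [hFy] at h0
    have h1 := huk 0 (by omega)
    apply hJ
    rw [evalJet_jacobian]
    simp only [delta, derivNumerator, map_add, map_mul, evalJet_jet, evalJet_dy,
      Indet.value, Function.iterate_succ, Function.iterate_zero, Function.comp, id, Nat.mul_zero,
      zero_add, pow_one] at h1
    change iteratedDeriv 1 u (ψ (x₀, y₀)) * (pdx ψ (x₀, y₀) + pdy ψ (x₀, y₀) * Z 0) =
      pdx φ (x₀, y₀) + pdy φ (x₀, y₀) * Z 0 at h1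
    change pdx φ (x₀, y₀) * pdy ψ (x₀, y₀) - pdy φ (x₀, y₀) * pdx ψ (x₀, y₀) = 0
    linear_combination -pdy ψ (x₀, y₀) * h1 -
      (pdx ψ (x₀, y₀) + pdy ψ (x₀, y₀) * Z 0) * h0
  obtain ⟨y, hya, rfl, hy⟩ := exists_implicit_function hFa (by simp [hu0']) hFy0
  have hg : GraphMapsAt w y u x₀ :=
    ⟨hwU _ hp, hya, hua, hy.mono fun s hs => (sub_eq_zero.1 hs).symm⟩
  have hwe : ∀ᶠ q in 𝓝 (x₀, y x₀), ∀ v, AnalyticAt ℂ (w v) q :=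
    Filter.eventually_of_mem hUp hwU
  have hjet : ∀ k < n - 1, graphJet y x₀ k = Z k := hg.graphJet_eq hwe hJ hδ huk
  have hreg : ∀ᶠ s in 𝓝 x₀, IsRegularAt f h y s := by
    have hc := (hasDerivAt_evalGraph hg.analytic hya
      (rename ofEqVar (denominator f))).continuousAt
    have h0 : evalGraph w y x₀ (rename ofEqVar (denominator f)) ≠ 0 := by
      rw [evalGraph, evalJet_congr (rename_ofEqVar_mem _) _ hjet]
      exact hN
    filter_upwards [hc.eventually_ne h0] with s hs
    rw [evalJet_rename_ofEqVar] at hs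
    exact hs
  have hall : ∀ᶠ s in 𝓝 x₀, IsRegularAt f h y s ∧ GraphMapsAt w y u s ∧ (s, y s) ∈ U ∧
      LinearOdeAt n (n - 2) b u (ψ (s, y s)) := by
    filter_upwards [hreg, hg.eventually hwe, hg.continuousAt_graph.eventually hUp,
      hg.continuousAt_psi.eventually hu] with s h1 h2 h3 h4
    exact ⟨h1, h2, h3, (linearOdeAt_padCoeff (Nat.sub_le n 2) _ _ _).1 h4⟩
  obtain ⟨V, hV, hVo, hxV⟩ := eventually_nhds_iff.1 hall
  have hode := (hmap V y u hVo (fun s hs => (hV s hs).2.1.analytic_y) (fun s hs => (hV s hs).2.2.1)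
    (fun s hs => (hV s hs).1) (by rintro _ ⟨s, hs, rfl⟩; exact (hV s hs).2.1.analytic_u)
    (fun s hs => (hV s hs).2.1.map_eq.self_of_nhds)).2 (fun s hs => (hV s hs).2.2.2) x₀ hxV
  have hlin := linearizationPoly_eq_zero (w := w) (b := b) hn hg hwe (fun k => rfl)
    (hV x₀ hxV).1 hode (hV x₀ hxV).2.2.2
  -- The curve has the prescribed derivatives only up to order `n - 1`, which is all that the
  -- polynomial involves.
  rwa [evalGraph, evalJet_congr (linearizationPoly_mem hn f) _ hjet] at hlin

/-- Over `p` neither `N` nor `δ` is the zero polynomial, so the restrictions `N ≠ 0` and `δ ≠ 0` on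
the jet can be dropped. -/
theorem MapsEquation.linearizationPoly_eq_zero (hn : 2 ≤ n)
    (hmap : MapsEquation f h b φ ψ U) (hU : IsPointTransformation φ ψ U)
    (hh : ∀ i, AnalyticOnNhd ℂ (h i) U) (hb : ∀ k, AnalyticOnNhd ℂ (b k) (ψ '' U))
    {p : ℂ × ℂ} (hp : p ∈ U) {z : Fin (n - 1) → ℂ} (hN : evalAt h p z (denominator f) ≠ 0)
    (Z : ℕ → ℂ) :
    evalJet Z (Indet.value (assign φ ψ (fun k q => b k (ψ q)) h) p) (linearizationPoly f) = 0 := by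
  set w : DepVar n m → ℂ × ℂ → ℂ := assign φ ψ (fun k q => b k (ψ q)) h with hw
  refine evalJet_eq_zero_of_ne_zero _ _ (rename ofEqVar (denominator f)) ?_ (fun Z hZ => ?_) Z
  · refine ⟨fun k => if hk : k < n - 1 then z ⟨k, hk⟩ else 0, ?_⟩
    rw [evalJet_rename_ofEqVar]
    simpa [hw, assign] using hN
  · have hδ : ∃ Z, evalJet Z (Indet.value w p) delta ≠ 0 := by
      by_contra! hcon
      have h0 := hcon 0
      have h1 := hcon 1
      have hJ := hU.jacobian_ne_zero p hp
      simp only [delta, map_add, map_mul, evalJet_jet, evalJet_dy, Pi.zero_apply, Pi.one_apply,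
        mul_zero, mul_one, add_zero] at h0 h1
      rw [h0, zero_add] at h1
      have h0' : pdx ψ p = 0 := h0
      have h1' : pdy ψ p = 0 := h1
      rw [h0', h1'] at hJ
      simp at hJ
    have h2 := evalJet_eq_zero_of_ne_zero (Indet.value w p)
      (linearizationPoly f * rename ofEqVar (denominator f)) delta hδ (fun Z hZ => ?_) Z
    · rw [map_mul] at h2
      exact (mul_eq_zero.1 h2).resolve_right hZ
    · rw [map_mul, mul_eq_zero]
      by_cases h0 : evalJet Z (Indet.value w p) (rename ofEqVar (denominator f)) = 0
      · exact Or.inr h0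
      · exact Or.inl (hmap.linearizationPoly_eq_zero_of_ne_zero hn hU hh hb hp Z h0 hZ)

end Converse

theorem isConsistent_of_isLinearizableToNormalForm (hn : 2 ≤ n) {f : RatFun n m}
    {h : Fin m → ℂ × ℂ → ℂ} {D : Set (ℂ × ℂ)} (hDc : IsConnected D)
    (hh : ∀ i, AnalyticOnNhd ℂ (h i) D)
    (hN : ∃ p ∈ D, ∃ z : Fin (n - 1) → ℂ, evalAt h p z (denominator f) ≠ 0)
    (hf : IsLinearizableToNormalForm f h D) : (linearizingSystem f).IsConsistent h D := by
  obtain ⟨U, φ, ψ, b, hUD, hU, hb, hmap⟩ := hf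
  obtain ⟨p₁, hp₁, z, hz⟩ := hN
  have hNa : AnalyticOnNhd ℂ (fun p => evalAt h p z (denominator f)) D := fun p hp =>
    analyticAt_evalAt (fun i => hh i p hp) z _
  -- For fixed `z`, the denominator is a holomorphic function of the point. By the identity theorem
  -- on the connected `D` it cannot vanish on all of `U`, and the solution lives where it is
  -- nonzero.
  have hne : ∃ p ∈ U, evalAt h p z (denominator f) ≠ 0 := by
    by_contra! hcon
    obtain ⟨p₀, hp₀⟩ := hU.nonempty
    exact hz (hNa.eqOn_zero_of_preconnected_of_eventuallyEq_zero hDc.isPreconnected (hUD hp₀)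
      (Filter.eventually_of_mem (hU.isOpen.mem_nhds hp₀) hcon) hp₁)
  have hhU : ∀ i, AnalyticOnNhd ℂ (h i) U := fun i => (hh i).mono hUD
  refine ⟨U ∩ (fun p => evalAt h p z (denominator f)) ⁻¹' {0}ᶜ, φ, ψ, fun k q => b k (ψ q),
    Set.inter_subset_left.trans hUD, ?_, ?_, ?_, ?_, ?_⟩
  · exact (hNa.mono hUD).continuousOn.isOpen_inter_preimage hU.isOpen isOpen_compl_singleton
  · obtain ⟨p, hp, hpz⟩ := hne
    exact ⟨p, hp, hpz⟩
  · rintro v q ⟨hq, -⟩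
    cases v with
    | phi => exact hU.analytic_phi q hq
    | psi => exact hU.analytic_psi q hq
    | a k => exact (hb k (ψ q) ⟨q, hq, rfl⟩).comp (hU.analytic_psi q hq)
    | h i => exact hhU i q hq
  · rintro g (hg | ⟨k, rfl⟩) p ⟨hp, hpz⟩
    · exact (coeffs_vanish_iff _ _).2
        (hmap.linearizationPoly_eq_zero hn hU hhU hb hp hpz) g hg
    · have hbk := (hb k (ψ p) ⟨p, hp, rfl⟩).differentiableAt.hasDerivAt
      have hx : pdx (fun q => b k (ψ q)) p = deriv (b k) (ψ p) * pdx ψ p :=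
        (HasDerivAt.comp (h := fun s => ψ (s, p.2)) p.1 hbk
          (hasDerivAt_pdx (hU.analytic_psi p hp))).deriv
      have hy : pdy (fun q => b k (ψ q)) p = deriv (b k) (ψ p) * pdy ψ p :=
        (HasDerivAt.comp (h := fun s => ψ (p.1, s)) p.2 hbk
          (hasDerivAt_pdy (hU.analytic_psi p hp))).deriv
      simp only [DiffPoly.jet, map_sub, map_mul, eval_X, Indet.value, assign,
        Function.iterate_succ, Function.iterate_zero, Function.comp, id, hx, hy]
      ring
  · rintro g rfl p ⟨hp, -⟩
    simpa [DiffPoly.jet, Indet.value, assign] using hU.jacobian_ne_zero p hp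

end

section

open Filter Topology

variable {n m : ℕ}

/-! ### Changes of variables in linear equations -/

/-- The coefficients in `(g · v ∘ τ)^{(k)} = ∑ j, substCoeff g τ k j · v^{(j)} ∘ τ`. -/
noncomputable def substCoeff (g τ : ℂ → ℂ) : ℕ → ℕ → ℂ → ℂ
  | 0, 0 => g
  | 0, _ + 1 => 0
  | k + 1, 0 => deriv (substCoeff g τ k 0)
  | k + 1, j + 1 => deriv (substCoeff g τ k (j + 1)) + deriv τ * substCoeff g τ k j

section SubstCoeff

variable {g τ : ℂ → ℂ} {t : ℂ}

theorem analyticAt_substCoeff (hg : AnalyticAt ℂ g t) (hτ : AnalyticAt ℂ τ t) (k j : ℕ) :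
    AnalyticAt ℂ (substCoeff g τ k j) t := by
  induction k generalizing j with
  | zero =>
    cases j with
    | zero => exact hg
    | succ j => exact analyticAt_const
  | succ k ih =>
    cases j with
    | zero => exact (ih 0).deriv
    | succ j => exact (ih (j + 1)).deriv.add (hτ.deriv.mul (ih j))

theorem substCoeff_eq_zero {k j : ℕ} (h : k < j) : substCoeff g τ k j = 0 := by
  induction k generalizing j with
  | zero =>
    obtain ⟨i, rfl⟩ := Nat.exists_eq_succ_of_ne_zero h.ne'
    rfl
  | succ k ih =>
    obtain ⟨i, rfl⟩ := Nat.exists_eq_succ_of_ne_zero (show j ≠ 0 by omega)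
    simp only [substCoeff]
    rw [ih (by omega), ih (by omega)]
    ext
    simp

theorem substCoeff_succ_self (k : ℕ) :
    substCoeff g τ (k + 1) (k + 1) = deriv τ * substCoeff g τ k k := by
  rw [substCoeff, substCoeff_eq_zero (Nat.lt_succ_self k)]
  ext
  simp

theorem substCoeff_self (k : ℕ) : substCoeff g τ k k = deriv τ ^ k * g := by
  induction k with
  | zero => rw [substCoeff, pow_zero, one_mul]
  | succ k ih => rw [substCoeff_succ_self, ih, pow_succ']; ring

theorem iteratedDeriv_subst {v : ℂ → ℂ} (hg : AnalyticAt ℂ g t) (hτ : AnalyticAt ℂ τ t)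
    (hv : AnalyticAt ℂ v (τ t)) (k : ℕ) :
    ∀ᶠ s in 𝓝 t, iteratedDeriv k (fun s => g s * v (τ s)) s =
      ∑ j ∈ Finset.range (k + 1), substCoeff g τ k j s * iteratedDeriv j v (τ s) := by
  induction k with
  | zero => exact Eventually.of_forall fun s => by simp [substCoeff]
  | succ k ih =>
    filter_upwards [ih.eventually_nhds, hg.eventually_analyticAt, hτ.eventually_analyticAt,
      hτ.continuousAt.eventually hv.eventually_analyticAt] with s hs h1 h2 h3
    have hd : ∀ j, HasDerivAt (fun s => substCoeff g τ k j s * iteratedDeriv j v (τ s))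
        (deriv (substCoeff g τ k j) s * iteratedDeriv j v (τ s) +
          substCoeff g τ k j s * (iteratedDeriv (j + 1) v (τ s) * deriv τ s)) s := fun j =>
      (analyticAt_substCoeff h1 h2 k j).differentiableAt.hasDerivAt.mul
        (HasDerivAt.comp s (hasDerivAt_iteratedDeriv h3 j) h2.differentiableAt.hasDerivAt)
    rw [iteratedDeriv_succ, EventuallyEq.deriv_eq hs,
      (HasDerivAt.fun_sum fun j _ => hd j).deriv, Finset.sum_add_distrib,
      Finset.sum_range_succ' _ (k + 1), Finset.sum_range_succ' _ k]
    simp only [substCoeff, Pi.add_apply, Pi.mul_apply, add_mul, Finset.sum_add_distrib]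
    rw [Finset.sum_range_succ (fun j => deriv (substCoeff g τ k (j + 1)) s *
      iteratedDeriv (j + 1) v (τ s)) k, substCoeff_eq_zero (Nat.lt_succ_self k)]
    simp only [deriv_zero, Pi.zero_apply, zero_mul, add_zero]
    rw [add_right_comm]
    congr 2
    refine Finset.sum_congr rfl fun j _ => by ring

/-- The coefficients of the equation for `v`, before division by the leading one, if
`u = g · v ∘ τ` satisfies the equation with coefficients `a`. -/
noncomputable def substEq (n : ℕ) {r : ℕ} (g τ : ℂ → ℂ) (a : Fin r → ℂ → ℂ) (j : ℕ) : ℂ → ℂ :=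
  fun t => substCoeff g τ n j t + ∑ k : Fin r, a k t * substCoeff g τ k j t

theorem analyticAt_substEq {r : ℕ} {a : Fin r → ℂ → ℂ} (hg : AnalyticAt ℂ g t)
    (hτ : AnalyticAt ℂ τ t) (ha : ∀ k, AnalyticAt ℂ (a k) t) (j : ℕ) :
    AnalyticAt ℂ (substEq n g τ a j) t :=
  (analyticAt_substCoeff hg hτ n j).add (Finset.analyticAt_fun_sum _ fun k _ =>
    (ha k).mul (analyticAt_substCoeff hg hτ k j))

theorem substEq_self {r : ℕ} (hr : r ≤ n) (a : Fin r → ℂ → ℂ) :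
    substEq n g τ a n t = deriv τ t ^ n * g t := by
  have h : ∀ k : Fin r, a k t * substCoeff g τ k n t = 0 := fun k => by
    rw [substCoeff_eq_zero (k.2.trans_le hr), Pi.zero_apply, mul_zero]
  rw [substEq, Finset.sum_eq_zero fun k _ => h k, substCoeff_self, add_zero]
  rfl

/-- Inserting the triangular expansion of each derivative and collecting by `v^{(j)}` produces
`substEq`. The coefficients with `s ≤ j < n` vanish, and the leading one is `τ'^n g`. -/
theorem linear_subst {v : ℂ → ℂ} {r s : ℕ} (hr : r ≤ n) (hs : s ≤ n) {a : Fin r → ℂ → ℂ}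
    (hg : AnalyticAt ℂ g t) (hτ : AnalyticAt ℂ τ t) (hv : AnalyticAt ℂ v (τ t))
    (h0 : ∀ j, s ≤ j → j < n → substEq n g τ a j t = 0) :
    iteratedDeriv n (fun s => g s * v (τ s)) t +
        ∑ k : Fin r, a k t * iteratedDeriv k (fun s => g s * v (τ s)) t =
      deriv τ t ^ n * g t * iteratedDeriv n v (τ t) +
        ∑ j : Fin s, substEq n g τ a j t * iteratedDeriv j v (τ t) := by
  have hk : ∀ k ≤ n, iteratedDeriv k (fun s => g s * v (τ s)) t =
      ∑ j ∈ Finset.range (n + 1), substCoeff g τ k j t * iteratedDeriv j v (τ t) := by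
    intro k hk
    rw [(iteratedDeriv_subst hg hτ hv k).self_of_nhds]
    refine Finset.sum_subset (Finset.range_subset_range.2 (by omega)) fun j _ hj => ?_
    rw [substCoeff_eq_zero (by simpa using hj), Pi.zero_apply, zero_mul]
  have h1 : iteratedDeriv n (fun s => g s * v (τ s)) t +
        ∑ k : Fin r, a k t * iteratedDeriv k (fun s => g s * v (τ s)) t =
      ∑ j ∈ Finset.range (n + 1), substEq n g τ a j t * iteratedDeriv j v (τ t) := by
    rw [hk n le_rfl, Finset.sum_congr rfl fun (k : Fin r) _ => by
      rw [hk k (k.2.le.trans hr), Finset.mul_sum], Finset.sum_comm, ← Finset.sum_add_distrib]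
    refine Finset.sum_congr rfl fun j _ => ?_
    rw [substEq, add_mul, Finset.sum_mul]
    simp only [mul_assoc]
  rw [h1, Finset.sum_range_succ, substEq_self hr, add_comm,
    Fin.sum_univ_eq_sum_range (fun j => substEq n g τ a j t * iteratedDeriv j v (τ t)) s]
  congr 1
  symm
  refine Finset.sum_subset (Finset.range_subset_range.2 hs) fun j hj hj' => ?_
  rw [h0 j (by simpa using hj') (by simpa using hj), zero_mul]

end SubstCoeff

/-- Local inverses of analytic functions of one variable. -/
theorem exists_local_inverse_one {τ : ℂ → ℂ} {t : ℂ} (hτ : AnalyticAt ℂ τ t)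
    (h' : deriv τ t ≠ 0) :
    ∃ σ : ℂ → ℂ, AnalyticAt ℂ σ (τ t) ∧ ∀ᶠ s in 𝓝 t, σ (τ s) = s :=
  ⟨_, hτ.analyticAt_localInverse h', HasStrictDerivAt.eventually_left_inverse _ _⟩

/-- Linearizability is preserved, if the target is transformed by `u = g(t) v`, `s = τ(t)`. -/
theorem IsLinearizableTo.subst {r s : ℕ} (hr : r ≤ n) (hs : s ≤ n) {f : RatFun n m}
    {h : Fin m → ℂ × ℂ → ℂ} {D : Set (ℂ × ℂ)} (hf : IsLinearizableTo r f h D)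
    (H : ∀ (a : Fin r → ℂ → ℂ) (t : ℂ), (∀ k, AnalyticAt ℂ (a k) t) →
      ∃ g τ : ℂ → ℂ, AnalyticAt ℂ g t ∧ AnalyticAt ℂ τ t ∧ g t ≠ 0 ∧ deriv τ t ≠ 0 ∧
        ∀ᶠ t' in 𝓝 t, ∀ j, s ≤ j → j < n → substEq n g τ a j t' = 0) :
    IsLinearizableTo s f h D := by
  obtain ⟨U, φ, ψ, a, hUD, hU, ha, hmap⟩ := hf
  obtain ⟨p₀, hp₀⟩ := hU.nonempty
  obtain ⟨g, τ, hg, hτ, hg0, hτ0, h0⟩ := H a (ψ p₀) fun k => ha k _ ⟨p₀, hp₀, rfl⟩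
  obtain ⟨σ, hσ, hστ⟩ := exists_local_inverse_one hτ hτ0
  have hall : ∀ᶠ t in 𝓝 (ψ p₀), AnalyticAt ℂ g t ∧ AnalyticAt ℂ τ t ∧ g t ≠ 0 ∧ deriv τ t ≠ 0 ∧
      (∀ j, s ≤ j → j < n → substEq n g τ a j t = 0) ∧ σ (τ t) = t ∧ AnalyticAt ℂ σ (τ t) := by
    filter_upwards [hg.eventually_analyticAt, hτ.eventually_analyticAt,
      hg.continuousAt.eventually_ne hg0, hτ.deriv.continuousAt.eventually_ne hτ0, h0, hστ,
      hτ.continuousAt.eventually hσ.eventually_analyticAt] with t h1 h2 h3 h4 h5 h6 h7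
    exact ⟨h1, h2, h3, h4, h5, h6, h7⟩
  obtain ⟨B, hB, hBo, hpB⟩ := eventually_nhds_iff.1 hall
  have hφ' : ∀ p ∈ U ∩ ψ ⁻¹' B, AnalyticAt ℂ (fun p => φ p / g (ψ p)) p := by
    rintro p ⟨hp, hpB⟩
    exact (hU.analytic_phi p hp).div ((hB _ hpB).1.comp (hU.analytic_psi p hp)) (hB _ hpB).2.2.1
  have hψ' : ∀ p ∈ U ∩ ψ ⁻¹' B, AnalyticAt ℂ (fun p => τ (ψ p)) p := by
    rintro p ⟨hp, hpB⟩
    exact (hB _ hpB).2.1.comp (hU.analytic_psi p hp)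
  -- As `u = g(t) v` and `s = τ(t)`, the new variables are `v = φ / g(ψ)` and `s = τ(ψ)`. The new
  -- coefficients are divided by the leading one and rewritten in `s` by the local inverse `σ` of
  -- `τ`.
  refine ⟨U ∩ ψ ⁻¹' B, fun p => φ p / g (ψ p), fun p => τ (ψ p),
    fun j t => substEq n g τ a j (σ t) / (deriv τ (σ t) ^ n * g (σ t)),
    Set.inter_subset_left.trans hUD, ⟨?_, ⟨p₀, hp₀, hpB⟩, hφ', hψ', ?_, ?_⟩, ?_, ?_⟩
  · exact hU.analytic_psi.continuousOn.isOpen_inter_preimage hU.isOpen hBo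
  · rintro p ⟨hp, hpB⟩ q ⟨hq, hqB⟩ hpq
    simp only [Prod.mk.injEq] at hpq
    obtain ⟨h1, h2⟩ := hpq
    have hψpq : ψ p = ψ q := by
      rw [← (hB _ hpB).2.2.2.2.2.1, h2, (hB _ hqB).2.2.2.2.2.1]
    refine hU.injOn hp hq (Prod.ext ?_ hψpq)
    rw [hψpq] at h1
    exact (div_left_inj' (hB _ hqB).2.2.1).1 h1
  · rintro p ⟨hp, hpB⟩
    obtain ⟨hg, hτ, hg0, hτ0, -⟩ := hB _ hpB
    have hgd := hg.differentiableAt.hasDerivAt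
    have hτd := hτ.differentiableAt.hasDerivAt
    have hφx := hasDerivAt_pdx (hU.analytic_phi p hp)
    have hφy := hasDerivAt_pdy (hU.analytic_phi p hp)
    have hψx := hasDerivAt_pdx (hU.analytic_psi p hp)
    have hψy := hasDerivAt_pdy (hU.analytic_psi p hp)
    have h1 : pdx (fun p => φ p / g (ψ p)) p =
        (pdx φ p * g (ψ p) - φ p * (deriv g (ψ p) * pdx ψ p)) / g (ψ p) ^ 2 :=
      (hφx.div (HasDerivAt.comp (h := fun s => ψ (s, p.2)) p.1 hgd hψx) hg0).deriv
    have h2 : pdy (fun p => φ p / g (ψ p)) p =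
        (pdy φ p * g (ψ p) - φ p * (deriv g (ψ p) * pdy ψ p)) / g (ψ p) ^ 2 :=
      (hφy.div (HasDerivAt.comp (h := fun s => ψ (p.1, s)) p.2 hgd hψy) hg0).deriv
    have h3 : pdx (fun p => τ (ψ p)) p = deriv τ (ψ p) * pdx ψ p :=
      (HasDerivAt.comp (h := fun s => ψ (s, p.2)) p.1 hτd hψx).deriv
    have h4 : pdy (fun p => τ (ψ p)) p = deriv τ (ψ p) * pdy ψ p :=
      (HasDerivAt.comp (h := fun s => ψ (p.1, s)) p.2 hτd hψy).deriv
    -- The derivative of `g` drops out: the new Jacobian is the old one times `τ' / g`.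
    have h5 : pdx (fun p => φ p / g (ψ p)) p * pdy (fun p => τ (ψ p)) p -
        pdy (fun p => φ p / g (ψ p)) p * pdx (fun p => τ (ψ p)) p =
        deriv τ (ψ p) / g (ψ p) * (pdx φ p * pdy ψ p - pdy φ p * pdx ψ p) := by
      rw [h1, h2, h3, h4]
      field_simp
      ring
    rw [h5]
    exact mul_ne_zero (div_ne_zero hτ0 hg0) (hU.jacobian_ne_zero p hp)
  · rintro j _ ⟨p, ⟨hp, hpB⟩, rfl⟩
    obtain ⟨hg, hτ, hg0, hτ0, -, hστ, hσ⟩ := hB _ hpB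
    have hq : AnalyticAt ℂ (fun t => substEq n g τ a j t / (deriv τ t ^ n * g t))
        (σ (τ (ψ p))) := by
      rw [hστ]
      exact (analyticAt_substEq hg hτ (fun k => ha k _ ⟨p, hp, rfl⟩) j).div
        ((hτ.deriv.pow n).mul hg) (mul_ne_zero (pow_ne_zero _ hτ0) hg0)
    exact AnalyticAt.comp (f := σ) hq hσ
  · intro V y v hV hy hyU hreg hv hvφ
    have hφg : ∀ x ∈ V, g (ψ (x, y x)) * v (τ (ψ (x, y x))) = φ (x, y x) := by
      intro x hx
      rw [hvφ x hx, mul_div_cancel₀ _ (hB _ (hyU x hx).2).2.2.1]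
    have hua : AnalyticOnNhd ℂ (fun t => g t * v (τ t)) ((fun x => ψ (x, y x)) '' V) := by
      rintro _ ⟨x, hx, rfl⟩
      obtain ⟨hg, hτ, -⟩ := hB _ (hyU x hx).2
      exact hg.mul (AnalyticAt.comp (f := τ) (hv _ ⟨x, hx, rfl⟩) hτ)
    rw [hmap V y (fun t => g t * v (τ t)) hV hy (fun x hx => (hyU x hx).1) hreg hua hφg]
    refine forall₂_congr fun x hx => ?_
    obtain ⟨hg, hτ, hg0, hτ0, h0, hστ, -⟩ := hB _ (hyU x hx).2
    have hc : deriv τ (ψ (x, y x)) ^ n * g (ψ (x, y x)) ≠ 0 :=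
      mul_ne_zero (pow_ne_zero _ hτ0) hg0
    unfold LinearOdeAt
    rw [linear_subst hr hs hg hτ (hv _ ⟨x, hx, rfl⟩) h0]
    beta_reduce
    rw [hστ, ← mul_eq_zero_iff_left hc (b := iteratedDeriv n v (τ (ψ (x, y x))) + _), mul_add,
      Finset.mul_sum]
    refine iff_of_eq (congrArg (fun z => _ + z = 0) (Finset.sum_congr rfl fun j _ => ?_))
    rw [← mul_assoc, mul_div_cancel₀ _ hc]

end

section

open Filter Topology

variable {n m : ℕ}

/-! ### Laguerre–Forsyth normal form -/

/-- For `τ = id` this is the second term of the Leibniz rule for `(g v)^{(k+1)}`. -/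
theorem substCoeff_id_succ (g : ℂ → ℂ) (k : ℕ) :
    substCoeff g id (k + 1) k = ((k : ℂ) + 1) • deriv g := by
  induction k with
  | zero => simp [substCoeff]
  | succ k ih =>
    have h1 : substCoeff g id (k + 1) (k + 1) = g := by
      rw [substCoeff_self]
      ext t
      simp
    rw [substCoeff, ih, h1]
    ext t
    simp
    ring

/-- The coefficient of the derivative of order `n - 1` can be removed. -/
theorem IsLinearizableTo.pred (hn : 2 ≤ n) {f : RatFun n m} {h : Fin m → ℂ × ℂ → ℂ}
    {D : Set (ℂ × ℂ)} (hf : IsLinearizableTo n f h D) : IsLinearizableTo (n - 1) f h D := by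
  obtain ⟨l, rfl⟩ : ∃ l, n = l + 1 := ⟨n - 1, by omega⟩
  refine hf.subst le_rfl (Nat.sub_le _ _) fun a t ha => ?_
  have hl : ((l : ℂ) + 1) ≠ 0 := Nat.cast_add_one_ne_zero l
  -- With `n = l + 1`, the coefficient of `v^{(n-1)}` is `n g' + a_{n-1} g`; `g` is chosen to
  -- annihilate it.
  obtain ⟨g, hg, hg0, hgt⟩ := exists_linearOde_solution (n := 1) one_ne_zero
    (a := fun _ t => a (Fin.last l) t / (l + 1)) (c := t)
    (fun _ => (ha _).div analyticAt_const hl) (fun _ => 1)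
  have hg0' : g t = 1 := by simpa using hg0 0
  refine ⟨g, id, hg, analyticAt_id, by simp [hg0'], by simp, ?_⟩
  filter_upwards [hgt] with t' ht' j hj hjn
  obtain rfl : j = l := by omega
  rw [LinearOdeAt, Fin.sum_univ_one, Fin.val_zero, iteratedDeriv_one, iteratedDeriv_zero] at ht'
  have hz : ∀ k : Fin j, substCoeff g id k j t' = 0 := fun k => by
    rw [substCoeff_eq_zero k.2, Pi.zero_apply]
  rw [substEq, substCoeff_id_succ, Fin.sum_univ_castSucc]
  simp only [Fin.val_castSucc, hz, mul_zero, Finset.sum_const_zero, zero_add, Fin.val_last,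
    substCoeff_self, deriv_id', Pi.smul_apply, smul_eq_mul]
  simp only [Pi.mul_apply, Pi.pow_apply, one_pow, one_mul]
  field_simp at ht'
  linear_combination ht'

/-! ### The substitution `u = w^N v`, `ds = dt / w^2` -/

section Schwarzian

variable {w W q τ : ℂ → ℂ} {t : ℂ} {N : ℕ}

/-- `w'' + q w = 0`, `W = 1 / w` and `τ' = 1 / w²` at `t`. -/
structure IsSchwarzianAt (w W q τ : ℂ → ℂ) (t : ℂ) : Prop where
  deriv_w : HasDerivAt w (deriv w t) t
  deriv_deriv_w : HasDerivAt (deriv w) (-(q t * w t)) t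
  deriv_W : HasDerivAt W (-(W t ^ 2 * deriv w t)) t
  mul_eq : W t * w t = 1
  deriv_tau : deriv τ t = W t ^ 2

theorem exists_isSchwarzianAt (hq : AnalyticAt ℂ q t) :
    ∃ w W τ : ℂ → ℂ, AnalyticAt ℂ w t ∧ AnalyticAt ℂ τ t ∧
      ∀ᶠ t' in 𝓝 t, IsSchwarzianAt w W q τ t' := by
  obtain ⟨w, hw, hw0, hwt⟩ := exists_linearOde_solution (n := 2) two_ne_zero
    (a := ![q, 0]) (c := t) (by
      intro k
      fin_cases k
      · exact hq
      · exact analyticAt_const) (fun k => if k = 0 then 1 else 0)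
  have hw1 : w t ≠ 0 := by
    have : w t = 1 := by simpa using hw0 0
    simp [this]
  have hWa : AnalyticAt ℂ (fun s => (w s)⁻¹ ^ 2) t := (hw.inv hw1).pow 2
  obtain ⟨r, hr0, hr⟩ := Metric.eventually_nhds_iff_ball.1 hWa.eventually_analyticAt
  obtain ⟨τ, -, hτ⟩ := exists_primitive (f := fun s => (w s)⁻¹ ^ 2) (c := t) (r := r)
    fun s hs => (hr s hs).differentiableAt.differentiableWithinAt
  have hball : Metric.ball t r ∈ 𝓝 t := Metric.ball_mem_nhds t hr0
  have hτd : DifferentiableOn ℂ τ (Metric.ball t r) := fun s hs =>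
    (hτ s hs).differentiableAt.differentiableWithinAt
  refine ⟨w, fun s => (w s)⁻¹, τ, hw, hτd.analyticAt hball, ?_⟩
  filter_upwards [hwt, hw.eventually_analyticAt, hw.continuousAt.eventually_ne hw1, hball]
    with s h1 h2 h3 h4
  have hd := h2.differentiableAt.hasDerivAt
  refine ⟨hd, ?_, ?_, inv_mul_cancel₀ h3, (hτ s h4).deriv⟩
  · have h5 := hasDerivAt_iteratedDeriv h2 1
    rw [LinearOdeAt, Fin.sum_univ_two] at h1
    simp only [Matrix.cons_val_zero, Matrix.cons_val_one, Fin.val_zero, iteratedDeriv_zero,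
      Pi.zero_apply, zero_mul, add_zero] at h1
    rw [iteratedDeriv_one, eq_neg_of_add_eq_zero_left h1] at h5
    exact h5
  · refine (hd.inv h3).congr_deriv ?_
    field_simp

/-- The function is `w^{N-j}`, whose exponent may be negative; writing it with `W = 1 / w` keeps all
exponents natural. -/
theorem IsSchwarzianAt.hasDerivAt_pow_mul (h : IsSchwarzianAt w W q τ t) (j : ℕ) :
    HasDerivAt (fun s => w s ^ N * W s ^ j)
      (w t ^ N * W t ^ (j + 1) * ((N : ℂ) - j) * deriv w t) t := by
  have h1 := (h.deriv_w.pow N).mul (h.deriv_W.pow j)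
  refine h1.congr_deriv ?_
  have hm := h.mul_eq
  have hN : (N : ℂ) * w t ^ (N - 1) = N * w t ^ N * W t := by
    rcases N with _ | N
    · simp
    · rw [Nat.add_sub_cancel, pow_succ]
      linear_combination -((N + 1 : ℕ) : ℂ) * w t ^ N * hm
  have hj : (j : ℂ) * W t ^ (j - 1) * W t ^ 2 = j * W t ^ (j + 1) := by
    rcases j with _ | j
    · simp
    · rw [Nat.add_sub_cancel]
      ring
  simp only [Pi.pow_apply]
  linear_combination W t ^ j * deriv w t * hN - w t ^ N * deriv w t * hj

theorem IsSchwarzianAt.substCoeff_self (h : IsSchwarzianAt w W q τ t) (k : ℕ) :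
    substCoeff (fun s => w s ^ N) τ k k t = w t ^ N * W t ^ (2 * k) := by
  rw [LinODE.substCoeff_self, Pi.mul_apply, Pi.pow_apply, h.deriv_tau]
  ring

/-- The factor `N - k` is the reason for taking `N = n - 1`: at `k = n - 1` it vanishes, so no term
of order `n - 1` reappears. -/
theorem substCoeff_succ_eq (h : ∀ᶠ s in 𝓝 t, IsSchwarzianAt w W q τ s) (k : ℕ) :
    ∀ᶠ s in 𝓝 t, substCoeff (fun s => w s ^ N) τ (k + 1) k s =
      ((k : ℂ) + 1) * ((N : ℂ) - k) * (w s ^ N * W s ^ (2 * k + 1) * deriv w s) := by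
  induction k with
  | zero =>
    filter_upwards [h] with s hs
    have := (hs.hasDerivAt_pow_mul (N := N) 0).deriv
    simp only [pow_zero, mul_one] at this
    simp only [substCoeff, this]
    push_cast
    ring
  | succ k ih =>
    filter_upwards [h.eventually_nhds, ih] with s hs hk
    have h1 : deriv (substCoeff (fun s => w s ^ N) τ (k + 1) (k + 1)) s = _ :=
      (((hs.self_of_nhds.hasDerivAt_pow_mul (N := N) (2 * (k + 1))).congr_of_eventuallyEq
        (hs.mono fun s hs => hs.substCoeff_self (k + 1)))).deriv
    rw [substCoeff, Pi.add_apply, Pi.mul_apply, h1, hk, hs.self_of_nhds.deriv_tau]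
    push_cast
    ring

/-- At `k = N - 1` the factor `N - k - 1` removes the term with `w'^2`, and only a multiple of `q`
remains, which can be matched to a given coefficient. -/
theorem substCoeff_succ_succ_eq (h : ∀ᶠ s in 𝓝 t, IsSchwarzianAt w W q τ s) (k : ℕ) :
    ∀ᶠ s in 𝓝 t, substCoeff (fun s => w s ^ N) τ (k + 2) k s =
      w s ^ N * W s ^ (2 * k + 2) *
        (((k : ℂ) + 2) * (k + 1) * (N - k - 1) * (N - k) / 2 * deriv w s ^ 2 -
          ((k : ℂ) + 1) * (k + 2) * (3 * N - 2 * k) / 6 * (q s * w s ^ 2)) := by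
  have hd : ∀ k : ℕ, ∀ᶠ s in 𝓝 t, deriv (substCoeff (fun s => w s ^ N) τ (k + 1) k) s =
      ((k : ℂ) + 1) * ((N : ℂ) - k) * (w s ^ N * W s ^ (2 * k + 2) *
        ((N - 2 * k - 1) * deriv w s ^ 2 - q s * w s ^ 2)) := by
    intro k
    filter_upwards [h, (substCoeff_succ_eq h k).eventually_nhds] with s hs hk
    have h1 := ((hs.hasDerivAt_pow_mul (N := N) (2 * k + 1)).mul hs.deriv_deriv_w).const_mul
      (((k : ℂ) + 1) * ((N : ℂ) - k))
    rw [(h1.congr_of_eventuallyEq hk).deriv]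
    push_cast
    linear_combination (((k : ℂ) + 1) * ((N : ℂ) - k)) * w s ^ N * W s ^ (2 * k + 1) * q s * w s *
      hs.mul_eq
  induction k with
  | zero =>
    filter_upwards [hd 0] with s h1
    rw [substCoeff, h1]
    push_cast
    ring
  | succ k ih =>
    filter_upwards [h, hd (k + 1), ih] with s hs h1 h2
    rw [substCoeff, Pi.add_apply, Pi.mul_apply, h1, h2, hs.deriv_tau]
    push_cast
    ring

end Schwarzian

/-- The coefficient of the derivative of order `n - 2` can be removed as well. -/
theorem IsLinearizableTo.pred_pred (hn : 2 ≤ n) {f : RatFun n m} {h : Fin m → ℂ × ℂ → ℂ}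
    {D : Set (ℂ × ℂ)} (hf : IsLinearizableTo (n - 1) f h D) : IsLinearizableTo (n - 2) f h D := by
  obtain ⟨l, rfl⟩ : ∃ l, n = l + 2 := ⟨n - 2, by omega⟩
  change IsLinearizableTo (l + 1) f h D at hf
  refine hf.subst (Nat.le_succ _) (Nat.sub_le _ _) fun a t ha => ?_
  -- With `n = l + 2` this is the binomial coefficient of `n + 1` over `3`, the constant in
  -- `substCoeff_succ_succ_eq` for `N = l + 1` and `k = l`; hence `q = a_{n-2} / β`.
  set β : ℂ := ((l : ℂ) + 1) * (l + 2) * (l + 3) / 6 with hβ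
  have hβ0 : β ≠ 0 := by
    have h1 : (((l + 1 : ℕ) : ℂ) * ((l + 2 : ℕ) : ℂ) * ((l + 3 : ℕ) : ℂ) / 6) ≠ 0 :=
      div_ne_zero (mul_ne_zero (mul_ne_zero (Nat.cast_ne_zero.2 (by omega))
        (Nat.cast_ne_zero.2 (by omega))) (Nat.cast_ne_zero.2 (by omega))) (by norm_num)
    push_cast at h1
    exact h1
  obtain ⟨w, W, τ, hw, hτ, hs⟩ := exists_isSchwarzianAt (q := fun t => a (Fin.last l) t / β)
    ((ha (Fin.last l)).div analyticAt_const hβ0)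
  have hst := hs.self_of_nhds
  have hw0 : w t ≠ 0 := right_ne_zero_of_mul_eq_one hst.mul_eq
  have hW0 : W t ≠ 0 := left_ne_zero_of_mul_eq_one hst.mul_eq
  refine ⟨fun s => w s ^ (l + 1), τ, hw.pow _, hτ, pow_ne_zero _ hw0, ?_, ?_⟩
  · rw [hst.deriv_tau]
    exact pow_ne_zero _ hW0
  filter_upwards [hs, substCoeff_succ_eq (N := l + 1) hs (l + 1),
    substCoeff_succ_succ_eq (N := l + 1) hs l] with s h0 h1 h2 j hj hjl
  obtain rfl | rfl : j = l ∨ j = l + 1 := by omega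
  · have hz : ∀ k : Fin j, substCoeff (fun s => w s ^ (j + 1)) τ k j s = 0 := fun k => by
      rw [substCoeff_eq_zero k.2, Pi.zero_apply]
    rw [substEq, h2, Fin.sum_univ_castSucc]
    simp only [Fin.val_castSucc, hz, mul_zero, Finset.sum_const_zero, zero_add, Fin.val_last,
      h0.substCoeff_self]
    have hq : a (Fin.last j) s = β * (a (Fin.last j) s / β) := by rw [mul_div_cancel₀ _ hβ0]
    generalize a (Fin.last j) s / β = q at *
    rw [hq, hβ]
    push_cast
    -- The terms `-β q w^{N+2} W^{2j+2}` and `a_{n-2} w^N W^{2j}` cancel because `W w = 1`.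
    linear_combination -(((j : ℂ) + 1) * (j + 2) * (j + 3) / 6) * q * w s ^ (j + 1) *
      W s ^ (2 * j) * (W s * w s + 1) * h0.mul_eq
  · have hz : ∀ k : Fin (l + 1), substCoeff (fun s => w s ^ (l + 1)) τ k (l + 1) s = 0 :=
      fun k => by rw [substCoeff_eq_zero k.2, Pi.zero_apply]
    rw [substEq, h1]
    simp [hz]

theorem IsLinearizable.toNormalForm (hn : 2 ≤ n) {f : RatFun n m} {h : Fin m → ℂ × ℂ → ℂ}
    {D : Set (ℂ × ℂ)} (hf : IsLinearizable f h D) : IsLinearizableToNormalForm f h D :=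
  (IsLinearizableTo.pred hn hf).pred_pred hn

end

end LinODE

theorem mainTheorem1 (n m : ℕ) (hn : 2 ≤ n) (f : LinODE.RatFun n m)
    (D : Set (ℂ × ℂ)) (hD : IsOpen D) (hDc : IsConnected D)
    (h : Fin m → ℂ × ℂ → ℂ) (hh : ∀ i, AnalyticOnNhd ℂ (h i) D)
    (hN : ∃ p ∈ D, ∃ z : Fin (n - 1) → ℂ, LinODE.evalAt h p z (LinODE.denominator f) ≠ 0) :
    (LinODE.IsLinearizable f h D ↔ (LinODE.linearizingSystem f).IsConsistent h D) ∧
    (LinODE.IsLinearizableToNormalForm f h D ↔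
      (LinODE.linearizingSystem f).IsConsistent h D) := by
  have hnf : LinODE.IsLinearizableToNormalForm f h D ↔
      (LinODE.linearizingSystem f).IsConsistent h D :=
    ⟨LinODE.isConsistent_of_isLinearizableToNormalForm hn hDc hh hN,
      LinODE.isLinearizableToNormalForm_of_isConsistent hn⟩
  have hlin : LinODE.IsLinearizable f h D ↔ LinODE.IsLinearizableToNormalForm f h D :=
    ⟨fun hf => hf.toNormalForm hn, fun hf => LinODE.IsLinearizableTo.mono (Nat.sub_le n 2) hf⟩
  exact ⟨hlin.trans hnf, hnf⟩
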